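/- **Multilevel aggregation with delay.** Let $T$ be a finite rooted tree with root $\rho$ and positive edge weights $w$. A request is a triple $q=(v_q,r_q,d_q)$, where $v_q\neq\rho$ is a leaf of $T$, $r_q\in\mathbb{R}$ is the arrival time, and $d_q$ is a real-valued delay function that is continuous and non-decreasing on $[r_q,\infty)$ with $d_q(r_q)\ge 0$ and $d_q(t)\to\infty$ as $t\to\infty$. An instance is a finite multiset $Q$ of requests. A schedule is a finite set of transmissions, each consisting of a time $t$ and a subtree of $T$ that contains $\rho$; a transmission costs the total weight of the edges of its subtree. A request $q$ is served at the first time $t_q\ge r_q$ at which a subtree containing $v_q$ is transmitted. A schedule is feasible if it serves every request, and its cost is then the total cost of its transmissions plus the total delay cost $\sum_{q\in Q}d_q(t_q)$. Let $\mathrm{OPT}(Q)$ be the infimum of the costs of feasible schedules for $Q$. A deterministic online algorithm for $(T,w)$ assigns a schedule to every instance so that, for every time $t$, its transmissions up to and including time $t$ depend only on the requests with $r_q\le t$ (a request, with its whole delay function, is revealed on arrival). It is $c$-competitive if, for every instance $Q$, its schedule is feasible and costs at most $c\cdot\mathrm{OPT}(Q)$. The depth $D$ of $T$ is the largest number of edges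 on a path from $\rho$ to a node. **Theorem.** There is an $O(D^2)$-competitive deterministic online algorithm for multilevel aggregation with delay on any tree of depth $D$. That is, there is an absolute constant $C>0$ such that for every finite rooted tree $T$ with positive edge weights there is a deterministic online algorithm that is $C D^2$-competitive, where $D$ is the depth of $T$. -/

import Mathlib

/-! Online multilevel aggregation with delay.

Rooted trees are Mathlib's `RootedTree`: nodes ordered by ancestorship, with root `⊥` and with
`Order.pred v` the parent of `v`. The edge from a node `v ≠ ⊥` to its parent is identified with its
lower endpoint `v`, so an edge weighting is a function `w : T → ℝ` whose value at `⊥` plays no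
role. -/

namespace MultilevelAggregation

/-- The depth of a finite rooted tree: the largest number of edges on a path from the root to a
node `v`; these edges correspond to the proper ancestors of `v`. -/
noncomputable def treeDepth (T : RootedTree) [Fintype T] : ℕ :=
  Finset.univ.sup fun v : T => (Set.Iio v).ncard

/-- A leaf: a node without descendants, other than the root. -/
def IsLeaf {T : RootedTree} (v : T) : Prop :=
  v ≠ ⊥ ∧ IsMax v

/-- A request: the leaf on which it is released, its arrival time, and its delay function, which is
continuous and non-decreasing from the arrival on and tends to infinity. Values of `delay` before
the arrival are irrelevant. -/
structure Request (T : RootedTree) where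
  leaf : T
  release : ℝ
  delay : ℝ → ℝ
  isLeaf : IsLeaf leaf
  continuousOn_delay : ContinuousOn delay (Set.Ici release)
  monotoneOn_delay : MonotoneOn delay (Set.Ici release)
  delay_nonneg : 0 ≤ delay release
  tendsto_delay : Filter.Tendsto delay Filter.atTop Filter.atTop

/-- A transmission: at time `time`, a subtree containing the root, given by its set of nodes. -/
structure Transmission (T : RootedTree) where
  time : ℝ
  nodes : Finset T
  root_mem : ⊥ ∈ nodes
  ancestor_mem : IsLowerSet (nodes : Set T)

open Classical in
/-- The cost of a transmission: the total weight of the edges of the transmitted subtree. -/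
noncomputable def Transmission.weight {T : RootedTree} (w : T → ℝ) (x : Transmission T) : ℝ :=
  ∑ v ∈ x.nodes with v ≠ ⊥, w v

/-- The times at which the schedule `S` transmits the leaf of `q`, from the arrival of `q` on. -/
def serviceTimes {T : RootedTree} (S : Finset (Transmission T)) (q : Request T) : Set ℝ :=
  {t | q.release ≤ t ∧ ∃ x ∈ S, x.time = t ∧ q.leaf ∈ x.nodes}

/-- The schedule `S` is feasible for the instance `I`: every request is served. -/
def IsFeasible {T : RootedTree} (I : Multiset (Request T)) (S : Finset (Transmission T)) : Prop :=
  ∀ q ∈ I, (serviceTimes S q).Nonempty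

/-- The time at which `S` serves `q`: the first transmission of its leaf since its arrival. (A
minimum over a finite set, nonempty for feasible `S`.) -/
noncomputable def serviceTime {T : RootedTree} (S : Finset (Transmission T)) (q : Request T) : ℝ :=
  sInf (serviceTimes S q)

/-- Total cost of a feasible schedule: buying cost plus delay cost. -/
noncomputable def cost {T : RootedTree} (w : T → ℝ) (I : Multiset (Request T))
    (S : Finset (Transmission T)) : ℝ :=
  ∑ x ∈ S, x.weight w + (I.map fun q => q.delay (serviceTime S q)).sum

open Classical in
/-- A deterministic online algorithm on `T`: it maps each instance (a finite multiset of requests)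
to a schedule, in such a way that what it transmits up to time `t` depends only on the requests that
have arrived up to time `t`. -/
structure OnlineAlgorithm (T : RootedTree) where
  schedule : Multiset (Request T) → Finset (Transmission T)
  nonanticipating : ∀ (I J : Multiset (Request T)) (t : ℝ),
    (I.filter fun q => q.release ≤ t) = (J.filter fun q => q.release ≤ t) →
      ((schedule I).filter fun x => x.time ≤ t) = ((schedule J).filter fun x => x.time ≤ t)

/-- `A` is `c`-competitive for the edge weights `w`: on every instance it serves all requests, at a
cost of at most `c` times that of any feasible schedule, hence at most `c` times the optimum. -/
def OnlineAlgorithm.IsCompetitive {T : RootedTree} (A : OnlineAlgorithm T) (w : T → ℝ)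
    (c : ℝ) : Prop :=
  ∀ I : Multiset (Request T), IsFeasible I (A.schedule I) ∧
    ∀ S : Finset (Transmission T), IsFeasible I S →
      cost w I (A.schedule I) ≤ c * cost w I S

end MultilevelAggregation

/-! The algorithm lets explored nodes finance the exploration of nodes below them. While no service
is under way, the root invests delay as it accrues in real time. Once explored, a node `x ≠ ⊥` gets
a budget `w x`, which it spends at a fixed clock on covering future delay of arrived pending
requests below it. An investment in a request is credited to the counter of the unique topmost
unexplored node (front) above its leaf; a node whose counter reaches its weight is explored. Let `P
= - budget ⊥` be the root's total investment and `R` the total delay already present at the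
arrivals.

Cost of the algorithm. In the potential `flow`, a unit in the counter of `e` is worth `3 * level e`
and a unit of budget of `x` is worth `3 * level x - 2`. A unit invested by `x` covers one unit of
delay and enters a counter at least one level lower, so it is paid for. A full counter at `e` pays
for `w e` in the log, for a bounded number of steps and for the new budget. Since `flow` never
increases (`flow_step_le`) and the root has level `D + 1`, the cost is at most `(3 * D + 1) * P +
R`.

Comparison with a feasible `S`. Each counted investment splits into a part covering delay that `S`
also pays and a part `G e` covering delay after the service in `S`. If `G e > 0`, then `S` has
transmitted `e` since its last exploration, or `e` has spent its whole budget and all of it was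
counted in `V e` (`gain_of_lt`). As `G e` never exceeds the counter, it is bounded by `V e` plus `w
e` for each new transmission of `e` in `S` (`gain_le_add`). Summing over all nodes, the `V e` with
`e ≠ ⊥` cancel and `P + R ≤ cost w I S` remains (`neg_budget_bot_le`).

Together the cost is at most `3 * D + 1` times that of `S`, a bound linear in `D`; it is at most `4
* D ^ 2` when `D ≥ 1`. The two estimates also bound the number of steps (`exists_isDone`). The
algorithm is online because an unarrived request has no delay left to cover (`load_congr`). -/

namespace MultilevelAggregation

noncomputable section

open scoped Classical
open Filter Topology

variable {T : RootedTree}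

/-! ### Sums over an instance -/

/-- The sum of `f` over the requests of `I`, with multiplicity. -/
def total (I : Multiset (Request T)) (f : Request T → ℝ) : ℝ := (I.map f).sum

section total

variable {I : Multiset (Request T)} {f g : Request T → ℝ}

lemma total_add (I : Multiset (Request T)) (f g : Request T → ℝ) :
    total I (fun q => f q + g q) = total I f + total I g :=
  Multiset.sum_map_add

lemma total_mono (h : ∀ q ∈ I, f q ≤ g q) : total I f ≤ total I g :=
  Multiset.sum_map_le_sum_map f g h

lemma total_congr (h : ∀ q ∈ I, f q = g q) : total I f = total I g := by
  unfold total; rw [Multiset.map_congr rfl h]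

lemma total_zero (I : Multiset (Request T)) : total I (fun _ => 0) = 0 := by
  simp [total]

lemma total_nonneg (h : ∀ q ∈ I, 0 ≤ f q) : 0 ≤ total I f :=
  (total_zero I).symm.le.trans (total_mono h)

lemma exists_pos_of_total_pos (h : 0 < total I f) : ∃ q ∈ I, 0 < f q := by
  by_contra! hc
  exact absurd ((total_mono hc).trans (total_zero I).le) (not_le.2 h)

lemma le_total {q : Request T} (hq : q ∈ I) (h : ∀ q ∈ I, 0 ≤ f q) : f q ≤ total I f :=
  Multiset.single_le_sum (by simpa using h) _ (Multiset.mem_map_of_mem f hq)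

lemma total_finset_sum {ι : Type*} (I : Multiset (Request T)) (s : Finset ι)
    (f : ι → Request T → ℝ) :
    total I (fun q => ∑ i ∈ s, f i q) = ∑ i ∈ s, total I (f i) := by
  induction s using Finset.induction_on with
  | empty => simp [total_zero]
  | insert a s ha ih => simp only [Finset.sum_insert ha, total_add, ih]

lemma continuous_total {F : Request T → ℝ → ℝ} (h : ∀ q, Continuous (F q)) :
    Continuous fun t => total I fun q => F q t := by
  induction I using Multiset.induction_on with
  | empty => simpa [total] using continuous_const
  | cons a I ih =>
    simp only [total, Multiset.map_cons, Multiset.sum_cons]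
    exact (h a).add ih

lemma total_filter (I : Multiset (Request T)) (p : Request T → Prop) (h : ∀ q, ¬ p q → f q = 0) :
    total (I.filter p) f = total I f := by
  induction I using Multiset.induction_on with
  | empty => simp
  | cons a I ih =>
    by_cases hp : p a
    · simp_all [total]
    · simp_all [total]

end total

/-! ### Accrued delay -/

/-- The delay of `q` at time `t`, constant before the arrival. -/
def Request.accrued (q : Request T) (t : ℝ) : ℝ := q.delay (max t q.release)

namespace Request

variable (q : Request T)

lemma accrued_monotone : Monotone q.accrued := fun _ _ h =>
  q.monotoneOn_delay (Set.mem_Ici.2 (le_max_right _ _)) (Set.mem_Ici.2 (le_max_right _ _)) (max_le_max_right _ h)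

lemma accrued_of_le {t : ℝ} (h : q.release ≤ t) : q.accrued t = q.delay t := by
  rw [accrued, max_eq_left h]

lemma accrued_of_ge {t : ℝ} (h : t ≤ q.release) : q.accrued t = q.delay q.release := by
  rw [accrued, max_eq_right h]

lemma delay_release_le_accrued (t : ℝ) : q.delay q.release ≤ q.accrued t :=
  q.monotoneOn_delay Set.self_mem_Ici (Set.mem_Ici.2 (le_max_right _ _)) (le_max_right _ _)

lemma continuous_accrued : Continuous q.accrued :=
  q.continuousOn_delay.comp_continuous (by fun_prop) fun _ => Set.mem_Ici.2 (le_max_right _ _)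

lemma tendsto_accrued : Tendsto q.accrued atTop atTop :=
  q.tendsto_delay.congr' <| by
    filter_upwards [eventually_ge_atTop q.release] with t ht using (q.accrued_of_le ht).symm

end Request

/-! ### The algorithm -/

/-- A state of the algorithm. -/
structure State (T : RootedTree) where
  /-- the current time -/
  clock : ℝ
  /-- the nodes explored by the current service -/
  explored : Finset T
  /-- what is left of the budget of a node since its last exploration; at `⊥`, minus the total
  amount of delay that has triggered services -/
  budget : T → ℝ
  /-- the amount invested in a node since its last exploration -/
  counter : T → ℝ
  /-- the delay of a request for which investments have been made -/
  covered : Request T → ℝ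
  /-- the requests not served so far, including those that have not arrived -/
  pending : Set (Request T)
  /-- the explorations so far -/
  log : Finset (ℝ × T)
  /-- the number of steps so far -/
  steps : ℕ

namespace State

variable (I : Multiset (Request T)) (w : T → ℝ) (s : State T)

/-- A topmost unexplored node. -/
def IsFront (e : T) : Prop := Minimal (fun v => v ∉ s.explored) e

/-- A topmost unexplored node whose counter has reached its weight. -/
def IsFull (e : T) : Prop := s.IsFront e ∧ w e ≤ s.counter e

/-- The requests in which `x` may invest; the root `⊥` invests in real time. -/
def Participates (x : T) (q : Request T) : Prop :=
  q ∈ s.pending ∧ x ≤ q.leaf ∧ (x = ⊥ ∨ q.release ≤ s.clock)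

/-- The investment of `x` in `q` that covers its delay up to time `σ`. -/
def raise (x : T) (σ : ℝ) (q : Request T) : ℝ :=
  if s.Participates x q then max (s.covered q) (q.accrued σ) - s.covered q else 0

/-- The investment of `x` below `e` that covers all delay up to time `σ`. -/
def load (x : T) (σ : ℝ) (e : T) : ℝ :=
  total I fun q => if e ≤ q.leaf then s.raise x σ q else 0

/-- Covering the delay up to time `σ` exhausts the budget of `x` or fills a counter. -/
def Hits (x : T) (σ : ℝ) : Prop :=
  (x ≠ ⊥ ∧ s.budget x ≤ s.load I x σ x) ∨
    ∃ e, s.IsFront e ∧ w e - s.counter e ≤ s.load I x σ e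

/-- The first time at which the budget of `x` is exhausted or a counter is full. -/
def horizon (x : T) : ℝ := sInf {σ | s.clock ≤ σ ∧ s.Hits I w x σ}

/-- Explore `e`. -/
def explore (e : T) : State T where
  clock := s.clock
  explored := insert e s.explored
  budget := Function.update s.budget e (w e)
  counter := Function.update s.counter e 0
  covered := s.covered
  pending := {q ∈ s.pending | ¬ (q.leaf = e ∧ q.release ≤ s.clock)}
  log := insert (s.clock, e) s.log
  steps := s.steps + 1

/-- Let `x` invest in the delay up to time `σ`. -/
def sweep (x : T) (σ : ℝ) : State T where
  -- Only the root advances time; any other node pays for delay that lies in the future.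
  clock := if x = ⊥ then σ else s.clock
  explored := s.explored
  budget := Function.update s.budget x (s.budget x - s.load I x σ x)
  counter := fun e => if s.IsFront e then s.counter e + s.load I x σ e else s.counter e
  covered := fun q => s.covered q + s.raise x σ q
  pending := s.pending
  log := s.log
  steps := s.steps + 1

/-- End the current service. -/
def reset : State T := { s with explored := {⊥}, steps := s.steps + 1 }

/-- An explored node with positive budget and requests to invest in. -/
def IsActive (x : T) : Prop :=
  x ∈ s.explored ∧ x ≠ ⊥ ∧ 0 < s.budget x ∧ ∃ q ∈ I, s.Participates x q

/-- All requests are served and no service is under way. -/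
def IsDone : Prop :=
  (∀ e, ¬ s.IsFull w e) ∧ s.explored = {⊥} ∧ ∀ q ∈ I, q ∉ s.pending

/-- One step of the algorithm. -/
def step : State T :=
  -- `Classical.epsilon` depends on the predicate alone, so instances that induce the same predicate
  -- lead to the same choice.
  if ∃ e, s.IsFull w e then s.explore w (Classical.epsilon (s.IsFull w))
  else if ∃ x, s.IsActive I x then
    s.sweep I (Classical.epsilon (s.IsActive I)) (s.horizon I w (Classical.epsilon (s.IsActive I)))
  else if s.explored ≠ {⊥} then s.reset
  else if ∃ q ∈ I, q ∈ s.pending then s.sweep I ⊥ (s.horizon I w ⊥)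
  else s

/-- A node that may invest now. -/
structure IsPayer (x : T) : Prop where
  mem : x ∈ s.explored
  exists_participates : ∃ q ∈ I, s.Participates x q
  budget_pos : x ≠ ⊥ → 0 < s.budget x
  explored_eq : x = ⊥ → s.explored = {⊥}

variable {I w s}

/-- `IsPayer` merges the two kinds of sweep, by the root and by an active node, into one case. -/
theorem step_induction {P : State T → Prop}
    (explore : ∀ e, s.IsFull w e → P (s.explore w e))
    (sweep : (∀ e, ¬ s.IsFull w e) → ∀ x, s.IsPayer I x → P (s.sweep I x (s.horizon I w x)))
    (reset : (∀ e, ¬ s.IsFull w e) → (∀ x, ¬ s.IsActive I x) → s.explored ≠ {⊥} → P s.reset)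
    (done : s.IsDone I w → P s) : P (s.step I w) := by
  unfold step
  split_ifs with h1 h2 h3 h4
  · exact explore _ (Classical.epsilon_spec h1)
  · obtain ⟨h, h', h'', h'''⟩ := Classical.epsilon_spec h2
    exact sweep (not_exists.1 h1) _ ⟨h, h''', fun _ => h'', fun h => absurd h h'⟩
  · exact reset (not_exists.1 h1) (not_exists.1 h2) h3
  · push Not at h3
    obtain ⟨q, hq, hq'⟩ := h4
    exact sweep (not_exists.1 h1) _
      ⟨by simp [h3], ⟨q, hq, hq', bot_le, .inl rfl⟩, fun h => absurd rfl h, fun _ => h3⟩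
  · push Not at h3 h4
    exact done ⟨not_exists.1 h1, h3, h4⟩

lemma step_of_isDone (h : s.IsDone I w) : s.step I w = s := by
  unfold step
  have h2 : ¬ ∃ x, s.IsActive I x := by
    rintro ⟨x, -, -, -, q, hq, hx⟩
    exact h.2.2 q hq hx.1
  rw [if_neg (not_exists.2 h.1), if_neg h2, if_neg (not_not.2 h.2.1), if_neg]
  simpa using h.2.2

lemma raise_nonneg (s : State T) (x : T) (σ : ℝ) (q : Request T) : 0 ≤ s.raise x σ q := by
  unfold raise
  split_ifs
  · exact sub_nonneg.2 (le_max_left _ _)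
  · exact le_rfl

lemma covered_add_raise {x : T} {q : Request T} (h : s.Participates x q) (σ : ℝ) :
    s.covered q + s.raise x σ q = max (s.covered q) (q.accrued σ) := by
  rw [raise, if_pos h, add_sub_cancel]

lemma load_nonneg (I : Multiset (Request T)) (s : State T) (x : T) (σ : ℝ) (e : T) :
    0 ≤ s.load I x σ e :=
  total_nonneg fun q _ => by split_ifs; exacts [s.raise_nonneg x σ q, le_rfl]

lemma load_self (I : Multiset (Request T)) (s : State T) (x : T) (σ : ℝ) :
    s.load I x σ x = total I (s.raise x σ) :=
  total_congr fun q _ => by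
    split_ifs with h
    · rfl
    · rw [raise, if_neg fun h' => h h'.2.1]

lemma continuous_load (I : Multiset (Request T)) (s : State T) (x e : T) :
    Continuous fun σ => s.load I x σ e := by
  refine continuous_total fun q => ?_
  unfold raise
  split_ifs
  · exact (continuous_const.max q.continuous_accrued).sub continuous_const
  · exact continuous_const
  · exact continuous_const

end State

/-! ### Basic invariants -/

/-- The hitting set is closed, so its infimum is attained; overshooting a threshold there would give
an earlier hit by the intermediate value theorem. -/
lemma sInf_hitting_times {ι : Type*} [Finite ι] {f : ι → ℝ → ℝ} (hf : ∀ i, Continuous (f i))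
    {B : ι → ℝ} {p : ι → Prop} {a : ℝ} (ha : ∀ i, p i → f i a < B i)
    (hex : ∃ t, a ≤ t ∧ ∃ i, p i ∧ B i ≤ f i t) :
    (a ≤ sInf {t | a ≤ t ∧ ∃ i, p i ∧ B i ≤ f i t} ∧
      ∃ i, p i ∧ B i ≤ f i (sInf {t | a ≤ t ∧ ∃ i, p i ∧ B i ≤ f i t})) ∧
      ∀ i, p i → f i (sInf {t | a ≤ t ∧ ∃ i, p i ∧ B i ≤ f i t}) ≤ B i := by
  set S := {t | a ≤ t ∧ ∃ i, p i ∧ B i ≤ f i t} with hS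
  have hbdd : BddBelow S := ⟨a, fun t ht => ht.1⟩
  have hclosed : IsClosed S := by
    have : S = Set.Ici a ∩ ⋃ i, {t | p i ∧ B i ≤ f i t} := by ext; simp [hS]
    rw [this]
    refine isClosed_Ici.inter (isClosed_iUnion_of_finite fun i => ?_)
    by_cases hp : p i
    · simpa [hp] using isClosed_le continuous_const (hf i)
    · simp [hp]
  have hmem : sInf S ∈ S := hclosed.csInf_mem hex hbdd
  refine ⟨hmem, fun i hi => le_of_not_gt fun hlt => ?_⟩
  obtain ⟨t, ht, hft⟩ := intermediate_value_Icc hmem.1 (hf i).continuousOn ⟨(ha i hi).le, hlt.le⟩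
  have : sInf S ≤ t := csInf_le hbdd ⟨ht.1, i, hi, hft.ge⟩
  rw [le_antisymm ht.2 this] at hft
  exact hlt.ne' hft

namespace State

variable {I : Multiset (Request T)} {w : T → ℝ} {s : State T}

/-- The invariants of the algorithm that do not refer to another schedule. -/
structure IsValid (w : T → ℝ) (s : State T) : Prop where
  bot_mem : ⊥ ∈ s.explored
  lower : IsLowerSet (s.explored : Set T)
  release_le_covered : ∀ q : Request T, q.delay q.release ≤ s.covered q
  accrued_le : ∀ q ∈ s.pending, q.accrued s.clock ≤ s.covered q
  leaf_notMem : ∀ q ∈ s.pending, q.release ≤ s.clock → q.leaf ∉ s.explored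
  counter_nonneg : ∀ e, 0 ≤ s.counter e
  counter_le : ∀ e, s.counter e ≤ w e
  budget_nonneg : ∀ e, e ≠ ⊥ → 0 ≤ s.budget e
  logged : ∀ v ∈ s.explored, v ≠ ⊥ → (s.clock, v) ∈ s.log
  log_ne_bot : ∀ p ∈ s.log, p.2 ≠ ⊥
  log_lower : ∀ p ∈ s.log, ∀ u < p.2, u ≠ ⊥ → (p.1, u) ∈ s.log
  served : ∀ q ∉ s.pending, ∃ t, (t, q.leaf) ∈ s.log ∧ q.release ≤ t ∧ q.accrued t ≤ s.covered q

lemma IsFront.notMem {e : T} (h : s.IsFront e) : e ∉ s.explored := h.prop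

lemma IsFront.mem_of_lt {e u : T} (h : s.IsFront e) (hu : u < e) : u ∈ s.explored := by
  by_contra hc
  exact h.not_prop_of_lt hu hc

/-- The ancestors of a node form a chain, so the subtrees below distinct fronts are disjoint. -/
lemma IsFront.eq_of_le {e e' v : T} (h : s.IsFront e) (h' : s.IsFront e') (hv : e ≤ v)
    (hv' : e' ≤ v) : e = e' := by
  rcases le_total_of_directed hv hv' with h1 | h1
  · exact (Minimal.eq_of_le h h'.prop h1).symm
  · exact Minimal.eq_of_le h' h.prop h1

lemma exists_isFront_le [Finite T] {v : T} (h : v ∉ s.explored) : ∃ e, s.IsFront e ∧ e ≤ v := by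
  obtain ⟨e, he, he'⟩ := exists_minimal_le_of_wellFoundedLT (fun v => v ∉ s.explored) v h
  exact ⟨e, he', he⟩

/-! ### Preservation of the basic invariants -/

namespace IsValid

variable (hs : s.IsValid w)
include hs

lemma isFront_ne_bot {e : T} (h : s.IsFront e) : e ≠ ⊥ := fun he => h.notMem (he ▸ hs.bot_mem)

lemma leaf_notMem_of_participates {x : T} (hx : s.IsPayer I x) {q : Request T}
    (hq : s.Participates x q) : q.leaf ∉ s.explored := by
  rcases hq.2.2 with rfl | h
  · rw [hx.explored_eq rfl]
    simpa using q.isLeaf.1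
  · exact hs.leaf_notMem q hq.1 h

lemma lt_of_isFront {x e : T} (hx : s.IsPayer I x) (he : s.IsFront e) {q : Request T}
    (hq : s.Participates x q) (hle : e ≤ q.leaf) : x < e := by
  rcases le_total_of_directed hle hq.2.1 with h | h
  · exact lt_of_le_of_ne h fun h' => he.notMem (h' ▸ hx.mem)
  · exact absurd (hs.lower h hx.mem) he.notMem

lemma raise_clock (x : T) (q : Request T) : s.raise x s.clock q = 0 := by
  unfold raise
  split_ifs with h
  · rw [max_eq_left (hs.accrued_le q h.1), sub_self]
  · rfl

lemma load_clock (x e : T) : s.load I x s.clock e = 0 := by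
  simp only [load, hs.raise_clock, ite_self]
  exact total_zero I

/-- At the current clock nothing remains to be covered, so every load starts at zero, below its
threshold. A hit occurs because the delay of any participating request tends to infinity and its
front has finite remaining capacity. -/
lemma horizon_spec [Finite T] {x : T} (hx : s.IsPayer I x) (hfull : ∀ e, ¬ s.IsFull w e) :
    s.clock ≤ s.horizon I w x ∧ s.Hits I w x (s.horizon I w x) ∧
      (x ≠ ⊥ → s.load I x (s.horizon I w x) x ≤ s.budget x) ∧
      ∀ e, s.IsFront e → s.load I x (s.horizon I w x) e ≤ w e - s.counter e := by
  set p : T → Prop := fun i => i = x ∧ x ≠ ⊥ ∨ s.IsFront i with hp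
  set B : T → ℝ := fun i => if i = x then s.budget x else w i - s.counter i with hB
  have hne : ∀ e, s.IsFront e → e ≠ x := fun e he h => he.notMem (h ▸ hx.mem)
  have hiff : ∀ σ, s.Hits I w x σ ↔ ∃ i, p i ∧ B i ≤ s.load I x σ i := by
    intro σ
    constructor
    · rintro (h | ⟨e, he, h⟩)
      · exact ⟨x, .inl ⟨rfl, h.1⟩, by simpa [hB] using h.2⟩
      · exact ⟨e, .inr he, by simpa [hB, hne e he] using h⟩
    · rintro ⟨i, ⟨rfl, h⟩ | he, h'⟩
      · exact .inl ⟨h, by simpa [hB] using h'⟩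
      · exact .inr ⟨i, he, by simpa [hB, hne i he] using h'⟩
  have hset : {σ | s.clock ≤ σ ∧ s.Hits I w x σ} =
      {σ | s.clock ≤ σ ∧ ∃ i, p i ∧ B i ≤ s.load I x σ i} := by simp only [hiff]
  have key := sInf_hitting_times (f := fun i σ => s.load I x σ i) (B := B) (p := p) (a := s.clock)
    (fun i => continuous_load I s x i) ?_ ?_
  · rw [← hset] at key
    obtain ⟨⟨h1, h2⟩, h3⟩ := key
    refine ⟨h1, (hiff _).2 h2, fun h => ?_, fun e he => ?_⟩
    · simpa [hB, horizon] using h3 x (.inl ⟨rfl, h⟩)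
    · simpa [hB, hne e he, horizon] using h3 e (.inr he)
  · rintro i (⟨rfl, h⟩ | he)
    · simpa [hB, hs.load_clock] using hx.budget_pos h
    · simpa [hB, hs.load_clock, hne i he] using fun h => hfull i ⟨he, h⟩
  · obtain ⟨q, hq, hqp⟩ := hx.exists_participates
    obtain ⟨e, he, hle⟩ := exists_isFront_le (hs.leaf_notMem_of_participates hx hqp)
    obtain ⟨σ, h1, h2⟩ := ((eventually_ge_atTop s.clock).and
      (q.tendsto_accrued.eventually_ge_atTop (w e - s.counter e + s.covered q))).exists
    refine ⟨σ, h1, e, .inr he, ?_⟩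
    have h3 := le_total (f := fun q => if e ≤ q.leaf then s.raise x σ q else 0) hq fun q _ => by
      split_ifs
      exacts [s.raise_nonneg x σ q, le_rfl]
    simp only [if_pos hle, hB, if_neg (hne e he)] at h3 ⊢
    refine le_trans ?_ h3
    rw [raise, if_pos hqp]
    linarith [le_max_right (s.covered q) (q.accrued σ)]

lemma explore {e : T} (he : s.IsFull w e) (hw : ∀ v, v ≠ ⊥ → 0 < w v) :
    (s.explore w e).IsValid w where
  bot_mem := by simp [State.explore, hs.bot_mem]
  lower := by
    intro a b hba ha
    simp only [State.explore, Finset.coe_insert, Set.mem_insert_iff, Finset.mem_coe] at ha ⊢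
    rcases ha with rfl | ha
    · rcases hba.eq_or_lt with h | h
      · exact .inl h
      · exact .inr (he.1.mem_of_lt h)
    · exact .inr (hs.lower hba ha)
  release_le_covered := hs.release_le_covered
  accrued_le q hq := hs.accrued_le q hq.1
  leaf_notMem q hq hr := by
    simp only [State.explore, Finset.mem_insert, not_or]
    exact ⟨fun h => hq.2 ⟨h, hr⟩, hs.leaf_notMem q hq.1 hr⟩
  counter_nonneg v := by
    simp only [State.explore, Function.update_apply]
    split_ifs
    exacts [le_rfl, hs.counter_nonneg v]
  counter_le v := by
    simp only [State.explore, Function.update_apply]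
    split_ifs with h
    exacts [h ▸ (hw e (hs.isFront_ne_bot he.1)).le, hs.counter_le v]
  budget_nonneg v hv := by
    simp only [State.explore, Function.update_apply]
    split_ifs with h
    exacts [(hw e (hs.isFront_ne_bot he.1)).le, hs.budget_nonneg v hv]
  logged v hv hv' := by
    simp only [State.explore, Finset.mem_insert] at hv ⊢
    rcases hv with rfl | hv
    · exact .inl rfl
    · exact .inr (hs.logged v hv hv')
  log_ne_bot p hp := by
    simp only [State.explore, Finset.mem_insert] at hp
    rcases hp with rfl | hp
    · exact hs.isFront_ne_bot he.1
    · exact hs.log_ne_bot p hp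
  log_lower p hp u hu hu' := by
    simp only [State.explore, Finset.mem_insert] at hp ⊢
    rcases hp with rfl | hp
    · exact .inr (hs.logged u (he.1.mem_of_lt hu) hu')
    · exact .inr (hs.log_lower p hp u hu hu')
  served q hq := by
    by_cases h : q ∈ s.pending
    · have : q.leaf = e ∧ q.release ≤ s.clock := by
        by_contra hc
        exact hq ⟨h, hc⟩
      exact ⟨s.clock, by simp [State.explore, this.1], this.2, hs.accrued_le q h⟩
    · obtain ⟨t, h1, h2, h3⟩ := hs.served q h
      exact ⟨t, Finset.mem_insert_of_mem h1, h2, h3⟩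

lemma reset : s.reset.IsValid w :=
  { hs with
    bot_mem := by simp [State.reset]
    lower := by
      intro a b hba ha
      simp only [State.reset, Finset.coe_singleton, Set.mem_singleton_iff] at ha ⊢
      exact le_bot_iff.1 (ha ▸ hba)
    leaf_notMem := fun q _ _ => by simpa [State.reset] using q.isLeaf.1
    logged := fun v hv hv' => absurd (by simpa [State.reset] using hv) hv' }

lemma sweep [Finite T] {x : T} (hx : s.IsPayer I x) (hfull : ∀ e, ¬ s.IsFull w e) :
    (s.sweep I x (s.horizon I w x)).IsValid w := by
  obtain ⟨h1, -, h3, h4⟩ := hs.horizon_spec hx hfull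
  set σ := s.horizon I w x
  have hcov : ∀ q, s.covered q ≤ s.covered q + s.raise x σ q := fun q =>
    le_add_of_nonneg_right (s.raise_nonneg x σ q)
  refine ⟨hs.bot_mem, hs.lower, fun q => (hs.release_le_covered q).trans (hcov q), ?_, ?_, ?_, ?_,
    ?_, ?_, hs.log_ne_bot, hs.log_lower, ?_⟩
  · intro q hq
    -- When the root moves the clock, every pending request participates and is covered up to the
    -- new time; otherwise the clock stays.
    by_cases hb : x = ⊥
    · have hp : s.Participates x q := ⟨hq, hb ▸ bot_le, .inl hb⟩
      simp only [State.sweep, if_pos hb, covered_add_raise hp]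
      exact le_max_right _ _
    · simp only [State.sweep, if_neg hb]
      exact (hs.accrued_le q hq).trans (hcov q)
  · intro q hq hr
    by_cases hb : x = ⊥
    · simpa [State.sweep, hx.explored_eq hb] using q.isLeaf.1
    · exact hs.leaf_notMem q hq (by simpa [State.sweep, hb] using hr)
  · intro e
    simp only [State.sweep]
    split_ifs
    exacts [add_nonneg (hs.counter_nonneg e) (load_nonneg ..), hs.counter_nonneg e]
  · intro e
    simp only [State.sweep]
    split_ifs with he
    exacts [by linarith [h4 e he], hs.counter_le e]
  · intro e he
    simp only [State.sweep, Function.update_apply]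
    split_ifs with h
    exacts [sub_nonneg.2 (h3 (h ▸ he)), hs.budget_nonneg e he]
  · intro v hv hv'
    by_cases hb : x = ⊥
    · exact absurd (by simpa [State.sweep, hx.explored_eq hb] using hv) hv'
    · simpa [State.sweep, hb] using hs.logged v hv hv'
  · intro q hq
    obtain ⟨t, h1, h2, h3⟩ := hs.served q hq
    exact ⟨t, h1, h2, h3.trans (hcov q)⟩

lemma step [Finite T] (I : Multiset (Request T)) (hw : ∀ v, v ≠ ⊥ → 0 < w v) :
    (s.step I w).IsValid w :=
  step_induction (fun _ he => hs.explore he hw) (fun hfull _ hx => hs.sweep hx hfull)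
    (fun _ _ _ => hs.reset) (fun _ => hs)

end IsValid

end State

section

variable [Fintype T]

/-! ### The cost of the algorithm in terms of the delay that triggers its services -/

/-- The number of levels from `e` downwards, the root counting as an additional level. -/
def level (e : T) : ℝ := treeDepth T + 1 - (Set.Iio e).ncard

lemma level_bot : level (⊥ : T) = treeDepth T + 1 := by simp [level]

lemma one_le_level (e : T) : 1 ≤ level e := by
  have : (Set.Iio e).ncard ≤ treeDepth T :=
    Finset.le_sup (f := fun v : T => (Set.Iio v).ncard) (Finset.mem_univ e)
  have : ((Set.Iio e).ncard : ℝ) ≤ treeDepth T := by exact_mod_cast this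
  unfold level
  linarith

lemma level_add_one_le {x e : T} (h : x < e) : level e + 1 ≤ level x := by
  have : (Set.Iio x).ncard < (Set.Iio e).ncard :=
    Set.ncard_lt_ncard 
    ⟨Set.Iio_subset_Iio h.le, fun h' => lt_irrefl x (h' h)⟩ (Set.toFinite _)
  have : ((Set.Iio x).ncard : ℝ) + 1 ≤ (Set.Iio e).ncard := by exact_mod_cast this
  unfold level
  linarith

namespace State

variable {I : Multiset (Request T)} {w : T → ℝ} {s : State T}

/-- A bound on the number of steps until the next exploration. -/
def idleBound (w : T → ℝ) (s : State T) : ℕ :=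
  (s.explored.filter fun x => x ≠ ⊥ ∧ 0 < s.budget x).card + (if s.explored = {⊥} then 0 else 1) +
    if ∃ e, s.IsFull w e then 0 else 1

/-- A potential that does not increase during the algorithm. -/
def flow (I : Multiset (Request T)) (w : T → ℝ) (l : ℝ) (s : State T) : ℝ :=
  ∑ p ∈ s.log, w p.2 + l * ((s.steps + s.idleBound w : ℕ) : ℝ) +
    total I (fun q => s.covered q - q.delay q.release) +
    ∑ e, 3 * level e * s.counter e + ∑ e, (3 * level e - 2) * s.budget e

/-- Each participating request lies below exactly one front, so nothing is lost or counted twice. -/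
lemma IsValid.sum_isFront (hs : s.IsValid w) {x : T} (hx : s.IsPayer I x) {c : Request T → ℝ}
    (hc : ∀ q, ¬ s.Participates x q → c q = 0) :
    ∑ e, (if s.IsFront e then total I fun q => if e ≤ q.leaf then c q else 0 else 0) =
      total I c := by
  rw [← Finset.sum_filter, ← total_finset_sum]
  refine total_congr fun q _ => ?_
  by_cases hq : s.Participates x q
  · obtain ⟨e, he, hle⟩ := exists_isFront_le (hs.leaf_notMem_of_participates hx hq)
    rw [Finset.sum_eq_single_of_mem e (by simpa using he), if_pos hle]
    intro e' he' hne
    rw [if_neg fun h => hne ((Finset.mem_filter.1 he').2.eq_of_le he h hle)]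
  · simp [hc q hq]

lemma IsValid.sum_load (hs : s.IsValid w) {x : T} (hx : s.IsPayer I x) (σ : ℝ) :
    ∑ e, (if s.IsFront e then s.load I x σ e else 0) = s.load I x σ x := by
  rw [load_self]
  exact hs.sum_isFront hx fun q hq => if_neg hq

omit [Fintype T] in
lemma IsValid.load_eq_zero (hs : s.IsValid w) {x e : T} (hx : s.IsPayer I x) (he : s.IsFront e)
    (hxe : ¬ x < e) (σ : ℝ) : s.load I x σ e = 0 :=
  (total_congr fun q _ => by
    split_ifs with hle
    · exact if_neg fun hq => hxe (hs.lt_of_isFront hx he hq hle)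
    · rfl).trans (total_zero I)

/-- Each of the three summands grows by at most one. -/
lemma idleBound_explore_le (w : T → ℝ) (s : State T) (e : T) :
    (s.explore w e).idleBound w ≤ s.idleBound w + 3 := by
  have : ((s.explore w e).explored.filter fun x => x ≠ ⊥ ∧ 0 < (s.explore w e).budget x).card ≤
      (s.explored.filter fun x => x ≠ ⊥ ∧ 0 < s.budget x).card + 1 := by
    refine (Finset.card_le_card fun x hx => ?_).trans (Finset.card_insert_le e _)
    simp only [explore, Finset.mem_filter, Finset.mem_insert, Function.update_apply] at hx ⊢
    by_cases h : x = e
    · exact .inl h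
    · rw [if_neg h] at hx
      exact .inr ⟨hx.1.resolve_left h, hx.2⟩
  unfold idleBound
  split_ifs <;> omega

lemma idleBound_reset_lt (hfull : ∀ e, ¬ s.IsFull w e) (h : s.explored ≠ {⊥}) :
    s.reset.idleBound w + 1 ≤ s.idleBound w := by
  have : (s.reset.explored.filter fun x => x ≠ ⊥ ∧ 0 < s.reset.budget x) = ∅ := by
    ext x
    simp only [Finset.mem_filter, Finset.notMem_empty, iff_false]
    exact fun h => h.2.1 (Finset.mem_singleton.1 h.1)
  unfold idleBound
  rw [if_neg h, if_neg (not_exists.2 hfull), this, if_pos (by rfl)]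
  split_ifs <;> simp

/-- A sweep ends by exhausting the budget of `x`, which removes `x` from the first summand, or by
filling a counter, which kills the last summand. -/
lemma IsValid.idleBound_sweep_lt (hs : s.IsValid w) {x : T} (hx : s.IsPayer I x)
    (hfull : ∀ e, ¬ s.IsFull w e) :
    (s.sweep I x (s.horizon I w x)).idleBound w + 1 ≤ s.idleBound w := by
  obtain ⟨-, h2, h3, -⟩ := hs.horizon_spec hx hfull
  set σ := s.horizon I w x
  have hsub : ((s.sweep I x σ).explored.filter fun y => y ≠ ⊥ ∧ 0 < (s.sweep I x σ).budget y) ⊆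
      s.explored.filter fun y => y ≠ ⊥ ∧ 0 < s.budget y := by
    intro y hy
    simp only [State.sweep, Finset.mem_filter, Function.update_apply] at hy ⊢
    refine ⟨hy.1, hy.2.1, ?_⟩
    by_cases h : y = x
    · exact h ▸ hx.budget_pos (h ▸ hy.2.1)
    · simpa [h] using hy.2.2
  have hexp : ((s.sweep I x σ).explored = {⊥}) = (s.explored = {⊥}) := rfl
  rcases h2 with ⟨hb, h2⟩ | ⟨e, he, h2⟩
  · have := Finset.card_lt_card (hsub.ssubset_of_mem_notMem (a := x)
      (by simp [hx.mem, hb, hx.budget_pos hb]) fun h =>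
        absurd (Finset.mem_filter.1 h).2.2 (by simp [State.sweep, h2]))
    unfold idleBound
    rw [if_neg (not_exists.2 hfull)]
    simp only [hexp]
    split_ifs <;> omega
  · have := Finset.card_le_card hsub
    unfold idleBound
    have hf : (s.sweep I x σ).IsFull w e := by
      refine ⟨he, ?_⟩
      simp only [State.sweep, if_pos he]
      linarith
    rw [if_neg (not_exists.2 hfull),
      if_pos (show ∃ e, (s.sweep I x σ).IsFull w e from ⟨e, hf⟩)]
    simp only [hexp]
    omega

lemma sum_mul_update (a b : T → ℝ) (e : T) (y : ℝ) :
    ∑ v, a v * Function.update b e y v = ∑ v, a v * b v + a e * (y - b e) := by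
  rw [← sub_eq_iff_eq_add', ← Finset.sum_sub_distrib, Finset.sum_eq_single_of_mem e]
  · simp [mul_sub]
  · simp
  · intro v _ hv
    simp [hv]

/-- Emptying the counter releases at least `3 * level e * w e`. This pays `w e` for the log, `4 * l
≤ w e` for one step plus at most three in `idleBound`, and `(3 * level e - 2) * w e` for the new
budget. -/
lemma IsValid.flow_explore_le (hs : s.IsValid w) {e : T} (he : s.IsFull w e) {l : ℝ} (hl : 0 ≤ l)
    (hlw : 4 * l ≤ w e) : (s.explore w e).flow I w l ≤ s.flow I w l := by
  have h1 : ∑ p ∈ (s.explore w e).log, w p.2 ≤ w e + ∑ p ∈ s.log, w p.2 := by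
    simp only [State.explore]
    by_cases h : (s.clock, e) ∈ s.log
    · rw [Finset.insert_eq_of_mem h]
      linarith
    · rw [Finset.sum_insert h]
  have h2 : (((s.explore w e).steps + (s.explore w e).idleBound w : ℕ) : ℝ) ≤
      ((s.steps + s.idleBound w : ℕ) : ℝ) + 4 := by
    have := idleBound_explore_le w s e
    have : (s.explore w e).steps = s.steps + 1 := rfl
    exact_mod_cast (by omega)
  have h3 := mul_le_mul_of_nonneg_left h2 hl
  unfold flow
  simp only [show (s.explore w e).covered = s.covered from rfl,
    show (s.explore w e).counter = Function.update s.counter e 0 from rfl,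
    show (s.explore w e).budget = Function.update s.budget e (w e) from rfl, sum_mul_update]
  have h4 := one_le_level e
  have h5 := mul_le_mul_of_nonneg_left he.2 (by linarith : 0 ≤ 3 * level e)
  have h6 := mul_nonneg (by linarith : 0 ≤ 3 * level e - 2)
    (hs.budget_nonneg e (hs.isFront_ne_bot he.1))
  linarith

lemma flow_reset_le (hfull : ∀ e, ¬ s.IsFull w e) (h : s.explored ≠ {⊥}) {l : ℝ} (hl : 0 ≤ l) :
    s.reset.flow I w l ≤ s.flow I w l := by
  have h2 : ((s.reset.steps + s.reset.idleBound w : ℕ) : ℝ) ≤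
      ((s.steps + s.idleBound w : ℕ) : ℝ) := by
    have := idleBound_reset_lt hfull h
    have : s.reset.steps = s.steps + 1 := rfl
    exact_mod_cast (by omega)
  have h3 := mul_le_mul_of_nonneg_left h2 hl
  unfold flow
  simp only [show s.reset.covered = s.covered from rfl, show s.reset.counter = s.counter from rfl,
    show s.reset.budget = s.budget from rfl, show s.reset.log = s.log from rfl]
  linarith

/-- Investing a unit frees `3 * level x - 2 = 1 + 3 * (level x - 1)`: one for the covered delay, the
rest for counters strictly below `x`. -/
lemma IsValid.flow_sweep_le (hs : s.IsValid w) {x : T} (hx : s.IsPayer I x)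
    (hfull : ∀ e, ¬ s.IsFull w e) {l : ℝ} (hl : 0 ≤ l) :
    (s.sweep I x (s.horizon I w x)).flow I w l ≤ s.flow I w l := by
  have h1 := hs.idleBound_sweep_lt hx hfull
  set σ := s.horizon I w x
  have h2 : (((s.sweep I x σ).steps + (s.sweep I x σ).idleBound w : ℕ) : ℝ) ≤
      ((s.steps + s.idleBound w : ℕ) : ℝ) := by
    have : (s.sweep I x σ).steps = s.steps + 1 := rfl
    exact_mod_cast (by omega)
  have h3 := mul_le_mul_of_nonneg_left h2 hl
  have h4 : total I (fun q => (s.sweep I x σ).covered q - q.delay q.release) =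
      total I (fun q => s.covered q - q.delay q.release) + s.load I x σ x := by
    rw [load_self, ← total_add]
    exact total_congr fun q _ => by simp only [State.sweep]; ring
  have h5 : ∑ e, 3 * level e * (s.sweep I x σ).counter e ≤
      ∑ e, 3 * level e * s.counter e + 3 * (level x - 1) * s.load I x σ x := by
    rw [← hs.sum_load hx, Finset.mul_sum, ← Finset.sum_add_distrib]
    refine Finset.sum_le_sum fun e _ => ?_
    simp only [State.sweep]
    split_ifs with he
    · by_cases hxe : x < e
      · have := mul_le_mul_of_nonneg_right (level_add_one_le hxe) (load_nonneg I s x σ e)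
        linarith
      · simp [hs.load_eq_zero hx he hxe]
    · simp
  unfold flow
  simp only [show (s.sweep I x σ).log = s.log from rfl,
    show (s.sweep I x σ).budget = Function.update s.budget x (s.budget x - s.load I x σ x) from rfl,
    sum_mul_update]
  rw [h4]
  linarith

lemma IsValid.flow_step_le (hs : s.IsValid w) {l : ℝ} (hl : 0 ≤ l)
    (hlw : ∀ v, v ≠ ⊥ → 4 * l ≤ w v) : (s.step I w).flow I w l ≤ s.flow I w l :=
  step_induction (P := fun s' => s'.flow I w l ≤ s.flow I w l)
    (fun e he => hs.flow_explore_le he hl (hlw e (hs.isFront_ne_bot he.1)))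
    (fun hfull _ hx => hs.flow_sweep_le hx hfull hl) (fun hfull _ h => flow_reset_le hfull h hl)
    fun _ => le_rfl

end State

/-! ### Comparison with a feasible schedule -/

/-- The number of transmissions of `e` up to time `t`. -/
def visits (S : Finset (Transmission T)) (e : T) (t : ℝ) : ℕ :=
  (S.filter fun x => e ∈ x.nodes ∧ x.time ≤ t).card

omit [Fintype T] in
lemma visits_mono (S : Finset (Transmission T)) (e : T) : Monotone (visits S e) := fun _ _ h =>
  Finset.card_le_card (Finset.monotone_filter_right _ fun _ _ hx => ⟨hx.1, hx.2.trans h⟩)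

omit [Fintype T] in
lemma visits_lt {S : Finset (Transmission T)} {e : T} {a b : ℝ}
    (h : ∃ x ∈ S, e ∈ x.nodes ∧ a < x.time ∧ x.time ≤ b) : visits S e a + 1 ≤ visits S e b := by
  obtain ⟨x, hx, hxe, hax, hxb⟩ := h
  refine Finset.card_lt_card <| Finset.ssubset_of_subset_of_ssubset
    (Finset.Subset.refl _) ((Finset.ssubset_iff_of_subset ?_).2 ⟨x, ?_, ?_⟩)
  · exact Finset.monotone_filter_right _ fun y _ hy => ⟨hy.1, hy.2.trans (hax.le.trans hxb)⟩
  · exact Finset.mem_filter.2 ⟨hx, hxe, hxb⟩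
  · exact fun h => absurd (Finset.mem_filter.1 h).2.2 (not_le.2 hax)

namespace State

variable {I : Multiset (Request T)} {w : T → ℝ} {s : State T} {S : Finset (Transmission T)}
  {o : Request T → ℝ} {t τ V G : T → ℝ}

/-- The invariants that relate the algorithm to a schedule `S` serving each request `q` at time
`o q`. Here `t e` is the time of the last exploration of `e`, and `τ e` the time up to which it has
covered the delay of its requests; `V e` and `G e` are the amounts invested by and in `e` since
then, where an investment of `x` counts only if it ends before the next transmission of `x` in `S`
and, in the case of `G`, only as far as it covers delay after the service of the request in `S`. -/
structure IsComparable (I : Multiset (Request T)) (w : T → ℝ) (S : Finset (Transmission T))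
    (o : Request T → ℝ) (s : State T) (t τ V G : T → ℝ) : Prop where
  last_le : ∀ e, t e ≤ s.clock
  covers : ∀ e, ∀ q ∈ s.pending, e ≤ q.leaf → q.release ≤ t e → q.accrued (τ e) ≤ s.covered q
  exhausted : ∀ e ∉ s.explored, ∀ q ∈ I, q ∈ s.pending → e ≤ q.leaf → q.release ≤ t e →
    s.budget e = 0
  value : ∀ e, V e = w e - s.budget e ∨
    (∃ x ∈ S, e ∈ x.nodes ∧ t e < x.time ∧ x.time < τ e) ∨ ∀ q ∈ I, t e < q.release
  value_nonneg : ∀ e, 0 ≤ V e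
  value_bot : V ⊥ = - s.budget ⊥
  gain_le : ∀ e, G e ≤ s.counter e
  gain : ∀ e, G e ≤ 0 ∨ (∃ x ∈ S, e ∈ x.nodes ∧ t e < x.time ∧ x.time ≤ s.clock) ∨ w e ≤ V e
  sum_le : ∑ e, V e + total I (fun q => q.delay q.release) ≤
    total I (fun q => min (s.covered q) (q.accrued (o q))) + ∑ e, (w e * visits S e (t e) + G e)

/-! ### Preservation of the comparison with a feasible schedule -/

namespace IsComparable

/-- Either alternative of `gain` with `G e` positive supplies `w e` on the right, and `G e ≤ counter
e ≤ w e`. -/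
lemma gain_le_add (h : s.IsComparable I w S o t τ V G) (hs : s.IsValid w) (hw : ∀ v, 0 ≤ w v)
    (e : T) : G e ≤ V e + w e * (visits S e s.clock - visits S e (t e)) := by
  have hV := h.value_nonneg e
  have h1 : (visits S e (t e) : ℝ) ≤ visits S e s.clock := by
    exact_mod_cast visits_mono S e (h.last_le e)
  have h2 := mul_nonneg (hw e) (sub_nonneg.2 h1)
  rcases h.gain e with h' | h' | h'
  · linarith
  · have h3 : (visits S e (t e) : ℝ) + 1 ≤ visits S e s.clock := by
      exact_mod_cast visits_lt h'
    have h4 := mul_le_mul_of_nonneg_left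
      (by linarith : 1 ≤ (visits S e s.clock : ℝ) - visits S e (t e)) (hw e)
    linarith [h.gain_le e, hs.counter_le e]
  · linarith [h.gain_le e, hs.counter_le e]

/-- Clearing `V e` and `G e` and moving `t e` to the clock preserves `sum_le` exactly because of
`gain_le_add`. -/
lemma explore (h : s.IsComparable I w S o t τ V G) (hs : s.IsValid w) (hw : ∀ v, 0 ≤ w v) {e : T}
    (he : s.IsFull w e) :
    (s.explore w e).IsComparable I w S o (Function.update t e s.clock)
      (Function.update τ e s.clock) (Function.update V e 0) (Function.update G e 0) where
  last_le v := by
    simp only [Function.update_apply, State.explore]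
    split_ifs
    exacts [le_rfl, h.last_le v]
  covers v q hq hle hr := by
    simp only [Function.update_apply, State.explore] at hr ⊢
    split_ifs at hr ⊢
    exacts [hs.accrued_le q hq.1, h.covers v q hq.1 hle hr]
  exhausted v hv q hqI hq hle hr := by
    simp only [State.explore, Finset.mem_insert, not_or] at hv
    simp only [Function.update_apply, State.explore, if_neg hv.1] at hr ⊢
    exact h.exhausted v hv.2 q hqI hq.1 hle hr
  value v := by
    simp only [Function.update_apply, State.explore]
    split_ifs with hv
    · exact .inl (by rw [hv, sub_self])
    · exact h.value v
  value_nonneg v := by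
    simp only [Function.update_apply]
    split_ifs
    exacts [le_rfl, h.value_nonneg v]
  value_bot := by
    simp only [Function.update_apply, State.explore, if_neg (hs.isFront_ne_bot he.1).symm]
    exact h.value_bot
  gain_le v := by
    simp only [Function.update_apply, State.explore]
    split_ifs
    exacts [le_rfl, h.gain_le v]
  gain v := by
    simp only [Function.update_apply, State.explore]
    split_ifs
    exacts [.inl le_rfl, h.gain v]
  sum_le := by
    have h1 : ∑ v, Function.update V e 0 v = ∑ v, V v - V e := by
      simpa [sub_eq_add_neg] using sum_mul_update (fun _ => 1) V e 0
    have h2 : ∑ v, (w v * visits S v (Function.update t e s.clock v) + Function.update G e 0 v) =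
        ∑ v, (w v * visits S v (t v) + G v) +
          (w e * (visits S e s.clock - visits S e (t e)) - G e) := by
      rw [← sub_eq_iff_eq_add', ← Finset.sum_sub_distrib, Finset.sum_eq_single_of_mem e]
      · simp only [Function.update_self]
        ring
      · simp
      · intro v _ hv
        simp [hv]
    rw [h1, h2]
    have := h.gain_le_add hs hw e
    have := h.sum_le
    simp only [State.explore]
    linarith

/-- This establishes `exhausted` for the nodes leaving the service: none is active, so a node with a
pending arrived request below it has no budget left. -/
lemma reset (h : s.IsComparable I w S o t τ V G) (hs : s.IsValid w)
    (hact : ∀ x, ¬ s.IsActive I x) : s.reset.IsComparable I w S o t τ V G :=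
  { h with
    exhausted := fun e he q hqI hq hle hr => by
      by_cases hmem : e ∈ s.explored
      · have hne : e ≠ ⊥ := by simpa [State.reset] using he
        by_contra hb
        exact hact e ⟨hmem, hne, lt_of_le_of_ne (hs.budget_nonneg e hne) (Ne.symm hb),
          q, hqI, hq, hle, .inr (hr.trans (h.last_le e))⟩
      · exact h.exhausted e hmem q hqI hq hle hr }

/-- If a counted investment in `q` below `e` covers delay after the service of `q` in `S`, then `S`
has transmitted `e` since its last exploration, or that exploration has been counted in full. -/
lemma gain_of_lt (h : s.IsComparable I w S o t τ V G) (hs : s.IsValid w)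
    (ho : ∀ q ∈ I, q.release ≤ o q ∧ ∃ y ∈ S, y.time = o q ∧ q.leaf ∈ y.nodes)
    {x e : T} (hx : s.IsPayer I x) (he : s.IsFront e) {σ : ℝ}
    (hgood : x = ⊥ ∨ ¬ ∃ y ∈ S, x ∈ y.nodes ∧ s.clock < y.time ∧ y.time < σ)
    {q : Request T} (hqI : q ∈ I) (hq : s.Participates x q) (hle : e ≤ q.leaf)
    (h1 : s.covered q < q.accrued σ) (h2 : q.accrued (o q) < q.accrued σ) :
    (∃ y ∈ S, e ∈ y.nodes ∧ t e < y.time ∧ y.time ≤ (s.sweep I x σ).clock) ∨ w e ≤ V e := by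
  -- A transmission of `e` contains its ancestor `x`. For `x ≠ ⊥`, a counted investment excludes
  -- such a transmission strictly between the clock and `σ`; for the root, the new clock is `σ`.
  have hclock : ∀ y ∈ S, e ∈ y.nodes → y.time < σ → y.time ≤ (s.sweep I x σ).clock := by
    intro y hy hey hyσ
    simp only [State.sweep]
    split_ifs with hb
    · exact hyσ.le
    · by_contra! hc
      exact hgood.resolve_left hb
        ⟨y, hy, y.ancestor_mem (hs.lt_of_isFront hx he hq hle).le hey, hc, hyσ⟩
  obtain ⟨hro, y, hy, hyo, hyl⟩ := ho q hqI
  have hoσ : o q < σ := q.accrued_monotone.reflect_lt h2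
  have hey : e ∈ y.nodes := y.ancestor_mem hle hyl
  rcases lt_or_ge (t e) (o q) with hto | hto
  · exact .inl ⟨y, hy, hey, hyo ▸ hto, hclock y hy hey (hyo ▸ hoσ)⟩
  -- Here `q` had arrived by the last exploration of `e` and is still pending, so `e` has exhausted
  -- its budget, covering `q` only up to `τ e < σ`. Either all of that budget was counted, or `S`
  -- transmitted `e` between `t e` and `τ e`.
  · have hr : q.release ≤ t e := hro.trans hto
    have hτσ : τ e < σ := q.accrued_monotone.reflect_lt ((h.covers e q hq.1 hle hr).trans_lt h1)
    rcases h.value e with h' | ⟨z, hz, hez, htz, hzτ⟩ | h'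
    · rw [h.exhausted e he.notMem q hqI hq.1 hle hr, sub_zero] at h'
      exact .inr h'.ge
    · exact .inl ⟨z, hz, hez, htz, hclock z hz hez (hzτ.trans hτσ)⟩
    · exact absurd (h' q hqI) (not_lt.2 hr)

/-- An investment of `x ≠ ⊥` reaching beyond a later transmission of `x` in `S` is left uncounted;
that transmission then serves as the second alternative of `value`. Every other investment is added
to `V x` and, for its part beyond the service in `S`, to `G`. -/
lemma sweep (h : s.IsComparable I w S o t τ V G) (hs : s.IsValid w)
    (ho : ∀ q ∈ I, q.release ≤ o q ∧ ∃ y ∈ S, y.time = o q ∧ q.leaf ∈ y.nodes)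
    {x : T} (hx : s.IsPayer I x) (hfull : ∀ e, ¬ s.IsFull w e) :
    ∃ τ' V' G', (s.sweep I x (s.horizon I w x)).IsComparable I w S o t τ' V' G' := by
  obtain ⟨hσ, -, -, -⟩ := hs.horizon_spec hx hfull
  set σ := s.horizon I w x
  have hclock : s.clock ≤ (s.sweep I x σ).clock := by
    simp only [State.sweep]
    split_ifs
    exacts [hσ, le_rfl]
  have hcov : ∀ q, s.covered q ≤ (s.sweep I x σ).covered q := fun q =>
    le_add_of_nonneg_right (s.raise_nonneg x σ q)
  have hlast : ∀ e, t e ≤ (s.sweep I x σ).clock := fun e => (h.last_le e).trans hclock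
  have hcovers : ∀ e, ∀ q ∈ (s.sweep I x σ).pending, e ≤ q.leaf → q.release ≤ t e →
      q.accrued (Function.update τ x (max (τ x) σ) e) ≤ (s.sweep I x σ).covered q := by
    intro e q hq hle hr
    rw [Function.update_apply]
    split_ifs with hex
    · subst hex
      rw [q.accrued_monotone.map_max]
      refine max_le ((h.covers e q hq hle hr).trans (hcov q)) ?_
      have hp : s.Participates e q := ⟨hq, hle, .inr (hr.trans (h.last_le e))⟩
      simp only [State.sweep, covered_add_raise hp]
      exact le_max_right _ _
    · exact (h.covers e q hq hle hr).trans (hcov q)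
  have hexh : ∀ e ∉ (s.sweep I x σ).explored, ∀ q ∈ I, q ∈ (s.sweep I x σ).pending → e ≤ q.leaf →
      q.release ≤ t e → (s.sweep I x σ).budget e = 0 := by
    intro e he q hqI hq hle hr
    simp only [State.sweep]
    rw [Function.update_of_ne fun hex : e = x => he (hex ▸ hx.mem)]
    exact h.exhausted e he q hqI hq hle hr
  have hτ : ∀ e, τ e ≤ Function.update τ x (max (τ x) σ) e := by
    intro e
    rw [Function.update_apply]
    split_ifs with hex
    exacts [hex ▸ le_max_left _ _, le_rfl]
  have hcounter : ∀ e, s.counter e ≤ (s.sweep I x σ).counter e := by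
    intro e
    simp only [State.sweep]
    split_ifs
    exacts [le_add_of_nonneg_right (load_nonneg ..), le_rfl]
  by_cases hgood : x = ⊥ ∨ ¬ ∃ y ∈ S, x ∈ y.nodes ∧ s.clock < y.time ∧ y.time < σ
  -- The part of the investment in `q` that covers delay exceeding `q.accrued (o q)`.
  · set c : Request T → ℝ := fun q =>
      max (s.covered q + s.raise x σ q) (q.accrued (o q)) - max (s.covered q) (q.accrued (o q))
      with hc
    have hc0 : ∀ q, ¬ s.Participates x q → c q = 0 := fun q hq => by
      simp [hc, raise, if_neg hq]
    have hcr : ∀ q, c q ≤ s.raise x σ q := fun q => by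
      have := s.raise_nonneg x σ q
      simp only [hc]
      grind
    have hV : ∀ e, V e ≤ Function.update V x (V x + s.load I x σ x) e := by
      intro e
      rw [Function.update_apply]
      split_ifs with hex
      exacts [hex ▸ le_add_of_nonneg_right (load_nonneg ..), le_rfl]
    refine ⟨_, Function.update V x (V x + s.load I x σ x), fun e => G e +
      if s.IsFront e then total I fun q => if e ≤ q.leaf then c q else 0 else 0, hlast, hcovers,
      hexh, fun e => ?_, fun e => (h.value_nonneg e).trans (hV e), ?_, fun e => ?_, fun e => ?_, ?_⟩
    · rcases h.value e with h' | ⟨y, hy, hey, h1, h2⟩ | h'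
      · left
        simp only [State.sweep, Function.update_apply]
        split_ifs with hex
        · rw [← hex, h']
          ring
        · exact h'
      · exact .inr (.inl ⟨y, hy, hey, h1, h2.trans_le (hτ e)⟩)
      · exact .inr (.inr h')
    · simp only [State.sweep, Function.update_apply]
      split_ifs with hb
      · rw [← hb, h.value_bot]
        ring
      · exact h.value_bot
    · simp only [State.sweep]
      split_ifs with he
      · refine add_le_add (h.gain_le e) (total_mono fun q _ => ?_)
        split_ifs
        exacts [hcr q, le_rfl]
      · simpa using h.gain_le e
    · by_cases hpos : 0 < (if s.IsFront e then total I fun q => if e ≤ q.leaf then c q else 0 else 0)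
      · have he : s.IsFront e := by
          by_contra he
          simp [he] at hpos
        rw [if_pos he] at hpos
        obtain ⟨q, hqI, hq⟩ := exists_pos_of_total_pos hpos
        have hle : e ≤ q.leaf := by
          by_contra hle
          simp [hle] at hq
        rw [if_pos hle] at hq
        have hp : s.Participates x q := by
          by_contra hp
          exact hq.ne' (hc0 q hp)
        simp only [hc, covered_add_raise hp, sub_pos] at hq
        have h1 : s.covered q < q.accrued σ ∧ q.accrued (o q) < q.accrued σ := by
          constructor <;> grind
        exact .inr ((h.gain_of_lt hs ho hx he hgood hqI hp hle h1.1 h1.2).imp_right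
          fun h' => h'.trans (hV e))
      · rcases h.gain e with h' | ⟨y, hy, hey, h1, h2⟩ | h'
        · exact .inl (by linarith)
        · exact .inr (.inl ⟨y, hy, hey, h1, h2.trans hclock⟩)
        · exact .inr (.inr (h'.trans (hV e)))
    · have h1 : ∑ e, Function.update V x (V x + s.load I x σ x) e = ∑ e, V e + s.load I x σ x := by
        simpa using sum_mul_update (fun _ => 1) V x (V x + s.load I x σ x)
      -- The identity `min + max = sum` splits each investment into its parts below and above the
      -- delay paid by `S`.
      have h2 : total I (fun q => min ((s.sweep I x σ).covered q) (q.accrued (o q))) + total I c =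
          total I (fun q => min (s.covered q) (q.accrued (o q))) + s.load I x σ x := by
        rw [load_self, ← total_add, ← total_add]
        refine total_congr fun q _ => ?_
        have h3 := min_add_max ((s.sweep I x σ).covered q) (q.accrued (o q))
        have h4 := min_add_max (s.covered q) (q.accrued (o q))
        simp only [hc, State.sweep] at h3 ⊢
        linarith
      have h3 := h.sum_le
      simp only [← add_assoc]
      rw [h1, Finset.sum_add_distrib, hs.sum_isFront hx hc0]
      linarith
  -- The uncounted case: `V` and `G` stay fixed and only `τ x` advances.
  · have hb : x ≠ ⊥ := fun hb => hgood (.inl hb)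
    refine ⟨_, V, G, hlast, hcovers, hexh, fun e => ?_, h.value_nonneg, ?_,
      fun e => (h.gain_le e).trans (hcounter e), fun e => ?_, ?_⟩
    · by_cases hex : e = x
      · subst hex
        obtain ⟨y, hy, hey, h1, h2⟩ := not_not.1 fun h' => hgood (.inr h')
        refine .inr (.inl ⟨y, hy, hey, (h.last_le e).trans_lt h1, ?_⟩)
        rw [Function.update_self]
        exact h2.trans_le (le_max_right _ _)
      · simpa [State.sweep, hex] using h.value e
    · simp only [State.sweep]
      rw [Function.update_of_ne hb.symm]
      exact h.value_bot
    · rcases h.gain e with h' | ⟨y, hy, hey, h1, h2⟩ | h'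
      · exact .inl h'
      · exact .inr (.inl ⟨y, hy, hey, h1, h2.trans hclock⟩)
      · exact .inr (.inr h')
    · refine h.sum_le.trans (add_le_add_left (total_mono fun q _ => ?_) _)
      exact min_le_min_right _ (hcov q)

lemma step (h : s.IsComparable I w S o t τ V G) (hs : s.IsValid w) (hw : ∀ v, 0 ≤ w v)
    (ho : ∀ q ∈ I, q.release ≤ o q ∧ ∃ y ∈ S, y.time = o q ∧ q.leaf ∈ y.nodes) :
    ∃ t' τ' V' G', (s.step I w).IsComparable I w S o t' τ' V' G' :=
  step_induction (P := fun s' => ∃ t' τ' V' G', s'.IsComparable I w S o t' τ' V' G')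
    (fun _ he => ⟨_, _, _, _, h.explore hs hw he⟩)
    (fun hfull _ hx => ⟨_, h.sweep hs ho hx hfull⟩)
    (fun _ hact _ => ⟨_, _, _, _, h.reset hs hact⟩) fun _ => ⟨_, _, _, _, h⟩

lemma neg_budget_bot_le (h : s.IsComparable I w S o t τ V G) (hs : s.IsValid w)
    (hw : ∀ v, 0 ≤ w v) (hw0 : w ⊥ = 0) :
    - s.budget ⊥ + total I (fun q => q.delay q.release) ≤
      total I (fun q => q.accrued (o q)) + ∑ e, w e * (S.filter fun x => e ∈ x.nodes).card := by
  have h1 : total I (fun q => min (s.covered q) (q.accrued (o q))) ≤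
      total I (fun q => q.accrued (o q)) := total_mono fun q _ => min_le_right _ _
  have h2 : ∑ e, (w e * visits S e (t e) + G e) ≤
      ∑ e, (w e * (S.filter fun x => e ∈ x.nodes).card + if e = ⊥ then 0 else V e) := by
    refine Finset.sum_le_sum fun e _ => ?_
    split_ifs with he
    -- The root has weight zero, hence counter and gain at most zero.
    · subst he
      have := (h.gain_le ⊥).trans (hs.counter_le ⊥)
      simp only [hw0, zero_mul] at this ⊢
      linarith
    · have h3 := h.gain_le_add hs hw e
      have h4 : visits S e s.clock ≤ (S.filter fun x => e ∈ x.nodes).card :=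
        Finset.card_le_card (Finset.monotone_filter_right _ fun _ _ hx => hx.1)
      have h4 : (visits S e s.clock : ℝ) ≤ (S.filter fun x => e ∈ x.nodes).card := by
        exact_mod_cast h4
      have h5 := mul_le_mul_of_nonneg_left h4 (hw e)
      linarith
  have h3 : ∑ e, (if e = ⊥ then 0 else V e) = ∑ e, V e - V ⊥ := by
    rw [eq_sub_iff_add_eq, ← Finset.sum_erase_add _ V (Finset.mem_univ ⊥), add_left_inj]
    rw [← Finset.sum_erase (a := ⊥) _ (by simp)]
    exact Finset.sum_congr rfl fun e he => if_neg (Finset.ne_of_mem_erase he)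
  have h4 := h.sum_le
  rw [Finset.sum_add_distrib (f := fun e => w e * ((S.filter fun x => e ∈ x.nodes).card : ℝ)), h3,
    h.value_bot] at h2
  linarith

end IsComparable

end State

end

/-! ### Non-anticipation -/

lemma sInf_eq_of_inter_Iic_eq {A B : Set ℝ} {t : ℝ} (hA : BddBelow A) (hB : BddBelow B)
    (h : ∀ a ≤ t, a ∈ A ↔ a ∈ B) (hne : ∃ a ≤ t, a ∈ A) : sInf A = sInf B := by
  have key : ∀ {A B : Set ℝ}, BddBelow A → (∀ a ≤ t, a ∈ A ↔ a ∈ B) → (∃ a ≤ t, a ∈ A) →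
      sInf A ≤ sInf B := by
    rintro A B hA h ⟨a, hat, ha⟩
    refine le_csInf ⟨a, (h a hat).1 ha⟩ fun b hb => ?_
    rcases le_or_gt b t with hbt | hbt
    · exact csInf_le hA ((h b hbt).2 hb)
    · exact (csInf_le hA ha).trans (hat.trans hbt.le)
  obtain ⟨a, hat, ha⟩ := hne
  exact le_antisymm (key hA h ⟨a, hat, ha⟩)
    (key hB (fun b hb => (h b hb).symm) ⟨a, hat, (h a hat).1 ha⟩)

namespace State

variable {I J : Multiset (Request T)} {w : T → ℝ} {s : State T} {t : ℝ}

lemma log_subset_step (I : Multiset (Request T)) (w : T → ℝ) (s : State T) :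
    s.log ⊆ (s.step I w).log :=
  step_induction (P := fun s' => s.log ⊆ s'.log) (fun _ _ => Finset.subset_insert _ _)
    (fun _ _ _ => Finset.Subset.refl _) (fun _ _ _ => Finset.Subset.refl _)
    fun _ => Finset.Subset.refl _

lemma steps_step (h : ¬ s.IsDone I w) : (s.step I w).steps = s.steps + 1 :=
  step_induction (P := fun s' => s'.steps = s.steps + 1) (fun _ _ => rfl) (fun _ _ _ => rfl)
    (fun _ _ _ => rfl) fun h' => absurd h' h

lemma IsValid.clock_le_step [Finite T] (hs : s.IsValid w) (I : Multiset (Request T)) :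
    s.clock ≤ (s.step I w).clock :=
  step_induction (P := fun s' => s.clock ≤ s'.clock) (fun _ _ => le_rfl)
    (fun hfull x hx => by
      simp only [State.sweep]
      split_ifs
      exacts [(hs.horizon_spec hx hfull).1, le_rfl]) (fun _ _ _ => le_rfl) fun _ => le_rfl

lemma mem_of_filter_eq {I J : Multiset (Request T)}
    (hIJ : (I.filter fun q => q.release ≤ t) = J.filter fun q => q.release ≤ t) {q : Request T}
    (hq : q ∈ I) (hr : q.release ≤ t) : q ∈ J :=
  Multiset.mem_of_mem_filter (hIJ ▸ Multiset.mem_filter.2 ⟨hq, hr⟩)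

/-- Up to time `t`, the accrued delay of a request arriving after `t` is its delay at arrival, which
is already covered; hence the root's investment in it is zero. Other nodes invest only in arrived
requests. -/
lemma IsValid.load_congr (hs : s.IsValid w)
    (hIJ : (I.filter fun q => q.release ≤ t) = J.filter fun q => q.release ≤ t)
    (hst : s.clock ≤ t) {x : T} {σ : ℝ} (hσ : x ≠ ⊥ ∨ σ ≤ t) (e : T) :
    s.load I x σ e = s.load J x σ e := by
  have key : ∀ q : Request T, ¬ q.release ≤ t →
      (if e ≤ q.leaf then s.raise x σ q else 0) = 0 := by
    intro q hq
    rw [not_le] at hq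
    split_ifs
    · unfold raise
      split_ifs with hp
      · rcases hp.2.2 with hb | hr
        · rw [q.accrued_of_ge ((hσ.resolve_left (not_not.2 hb)).trans hq.le),
            max_eq_left (hs.release_le_covered q), sub_self]
        · exact absurd (hr.trans hst) (not_le.2 hq)
      · rfl
    · rfl
  rw [load, load, ← total_filter I (fun q => q.release ≤ t) key,
    ← total_filter J (fun q => q.release ≤ t) key, hIJ]

lemma IsValid.sweep_congr (hs : s.IsValid w)
    (hIJ : (I.filter fun q => q.release ≤ t) = J.filter fun q => q.release ≤ t)
    (hst : s.clock ≤ t) {x : T} {σ : ℝ} (hσ : x ≠ ⊥ ∨ σ ≤ t) :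
    s.sweep I x σ = s.sweep J x σ := by
  simp only [State.sweep, hs.load_congr hIJ hst hσ]

lemma IsValid.hits_congr (hs : s.IsValid w)
    (hIJ : (I.filter fun q => q.release ≤ t) = J.filter fun q => q.release ≤ t)
    (hst : s.clock ≤ t) {x : T} {σ : ℝ} (hσ : x ≠ ⊥ ∨ σ ≤ t) :
    s.Hits I w x σ ↔ s.Hits J w x σ := by
  simp only [Hits, hs.load_congr hIJ hst hσ]

lemma isActive_congr
    (hIJ : (I.filter fun q => q.release ≤ t) = J.filter fun q => q.release ≤ t)
    (hst : s.clock ≤ t) : s.IsActive I = s.IsActive J := by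
  have key : ∀ {I J : Multiset (Request T)},
      ((I.filter fun q => q.release ≤ t) = J.filter fun q => q.release ≤ t) →
      ∀ x, s.IsActive I x → s.IsActive J x := by
    rintro I J hIJ x ⟨h1, h2, h3, q, hq, hp⟩
    exact ⟨h1, h2, h3, q, mem_of_filter_eq hIJ hq ((hp.2.2.resolve_left h2).trans hst), hp⟩
  exact funext fun x => propext ⟨key hIJ x, key hIJ.symm x⟩

/-- The case `IsDone` is excluded because `I` may be finished while `J` still has later arrivals. In
a root sweep ending by time `t`, the counter that fills up has positive load from `J` as well, so
`J` also has a pending request. -/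
lemma IsValid.step_congr [Finite T] (hs : s.IsValid w)
    (hIJ : (I.filter fun q => q.release ≤ t) = J.filter fun q => q.release ≤ t)
    (ht : (s.step I w).clock ≤ t) (hdone : ¬ s.IsDone I w) : s.step I w = s.step J w := by
  have hst : s.clock ≤ t := (hs.clock_le_step I).trans ht
  have hact := isActive_congr hIJ hst
  by_cases h1 : ∃ e, s.IsFull w e
  · rw [State.step, State.step, if_pos h1, if_pos h1]
  by_cases h2 : ∃ x, s.IsActive I x
  · have hne : Classical.epsilon (s.IsActive I) ≠ ⊥ := (Classical.epsilon_spec h2).2.1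
    have hhor : s.horizon I w (Classical.epsilon (s.IsActive I)) =
        s.horizon J w (Classical.epsilon (s.IsActive I)) := by
      simp only [horizon, hs.hits_congr hIJ hst (.inl hne)]
    rw [State.step, State.step, if_neg h1, if_neg h1, if_pos h2, if_pos (hact ▸ h2), ← hact,
      hs.sweep_congr hIJ hst (.inl hne), hhor]
  have h2' : ¬ ∃ x, s.IsActive J x := hact ▸ h2
  by_cases h3 : s.explored ≠ {⊥}
  · rw [State.step, State.step, if_neg h1, if_neg h1, if_neg h2, if_neg h2', if_pos h3, if_pos h3]
  by_cases h4 : ∃ q ∈ I, q ∈ s.pending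
  · have hexp := not_not.1 h3
    have hfull := not_exists.1 h1
    have hx : s.IsPayer I ⊥ := by
      obtain ⟨q, hq, hq'⟩ := h4
      exact ⟨hs.bot_mem, ⟨q, hq, hq', bot_le, .inl rfl⟩, fun h => absurd rfl h, fun _ => hexp⟩
    rw [State.step, if_neg h1, if_neg h2, if_neg h3, if_pos h4] at ht ⊢
    have ht' : s.horizon I w ⊥ ≤ t := by simpa [State.sweep] using ht
    obtain ⟨h5, h6, -, -⟩ := hs.horizon_spec hx hfull
    have h4' : ∃ q ∈ J, q ∈ s.pending := by
      rcases (hs.hits_congr hIJ hst (.inr ht')).1 h6 with ⟨h, -⟩ | ⟨e, he, h⟩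
      · exact absurd rfl h
      · have : s.counter e < w e := lt_of_not_ge fun h => hfull e ⟨he, h⟩
        obtain ⟨q, hq, hpos⟩ := exists_pos_of_total_pos ((sub_pos.2 this).trans_le h)
        refine ⟨q, hq, ?_⟩
        by_contra hc
        have : s.raise ⊥ (s.horizon I w ⊥) q = 0 := if_neg fun h => hc h.1
        simp [this] at hpos
    have hhor : s.horizon I w ⊥ = s.horizon J w ⊥ :=
      sInf_eq_of_inter_Iic_eq ⟨s.clock, fun _ h => h.1⟩ ⟨s.clock, fun _ h => h.1⟩
        (fun σ hσ => and_congr_right fun _ => hs.hits_congr hIJ hst (.inr hσ)) ⟨_, ht', h5, h6⟩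
    rw [State.step, if_neg h1, if_neg h2', if_neg h3, if_pos h4',
      hs.sweep_congr hIJ hst (.inr ht'), hhor]
  · push Not at h3 h4
    exact absurd ⟨not_exists.1 h1, h3, h4⟩ hdone

/-! ### Runs of the algorithm -/

/-- The initial state, at time `c`. -/
def init (c : ℝ) : State T where
  clock := c
  explored := {⊥}
  budget := 0
  counter := 0
  covered q := q.accrued c
  pending := Set.univ
  log := ∅
  steps := 0

/-- The state after `n` steps, starting at the first arrival. -/
def run (I : Multiset (Request T)) (w : T → ℝ) (n : ℕ) : State T :=
  (fun s => step I w s)^[n] (init (sInf {r | ∃ q ∈ I, q.release = r}))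

lemma run_succ (I : Multiset (Request T)) (w : T → ℝ) (n : ℕ) :
    run I w (n + 1) = (run I w n).step I w :=
  Function.iterate_succ_apply' _ _ _

/-- The state at the end. -/
def final (I : Multiset (Request T)) (w : T → ℝ) : State T :=
  run I w (sInf {n | (run I w n).IsDone I w})

lemma isValid_init (hw : ∀ v, 0 ≤ w v) (c : ℝ) : (init c : State T).IsValid w where
  bot_mem := by simp [init]
  lower a b hba ha := by
    simp only [init, Finset.coe_singleton, Set.mem_singleton_iff] at ha ⊢
    exact le_bot_iff.1 (ha ▸ hba)
  release_le_covered q := q.delay_release_le_accrued c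
  accrued_le _ _ := le_rfl
  leaf_notMem q _ _ := by simpa [init] using q.isLeaf.1
  counter_nonneg _ := le_rfl
  counter_le := hw
  budget_nonneg _ _ := le_rfl
  logged v hv hv' := absurd (by simpa [init] using hv) hv'
  log_ne_bot := by simp [init]
  log_lower := by simp [init]
  served q hq := absurd (Set.mem_univ q) hq

lemma isValid_run [Finite T] (hw : ∀ v, v ≠ ⊥ → 0 < w v) (hw0 : w ⊥ = 0)
    (I : Multiset (Request T)) (n : ℕ) : (run I w n).IsValid w := by
  induction n with
  | zero =>
    refine isValid_init (fun v => ?_) _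
    rcases eq_or_ne v ⊥ with rfl | h
    exacts [hw0.ge, (hw v h).le]
  | succ n ih => exact run_succ I w n ▸ ih.step I hw

lemma finite_release (I : Multiset (Request T)) : {r | ∃ q ∈ I, q.release = r}.Finite :=
  ((I.toFinset.finite_toSet).image Request.release).subset fun r ⟨q, hq, hr⟩ =>
    ⟨q, by simpa using hq, hr⟩

lemma sInf_release_le {q : Request T} (hq : q ∈ I) :
    sInf {r | ∃ q ∈ I, q.release = r} ≤ q.release :=
  csInf_le (finite_release I).bddBelow ⟨q, hq, rfl⟩

lemma isDone_init (hw : ∀ v, v ≠ ⊥ → 0 < w v) (c : ℝ) : (init c : State T).IsDone 0 w := by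
  refine ⟨fun e he => ?_, rfl, by simp⟩
  have hne : e ≠ ⊥ := fun h => he.1.notMem (by simp [init, h])
  exact absurd he.2 (not_le.2 (hw e hne))

lemma final_zero (hw : ∀ v, v ≠ ⊥ → 0 < w v) : (final 0 w : State T).log = ∅ := by
  have : sInf {n | (run 0 w n : State T).IsDone 0 w} = 0 :=
    Nat.sInf_eq_zero.2 (.inl (isDone_init hw _))
  rw [final, this]
  rfl

/-- The step numbers may differ, since a finished run repeats its state. For `I = 0` the starting
time is a default value, so the empty instance is excluded. -/
lemma exists_run_eq [Finite T] (hw : ∀ v, v ≠ ⊥ → 0 < w v) (hw0 : w ⊥ = 0)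
    (hIJ : (I.filter fun q => q.release ≤ t) = J.filter fun q => q.release ≤ t) (hI : I ≠ 0)
    (n : ℕ) (hn : (run I w n).clock ≤ t) : ∃ m, run J w m = run I w n := by
  induction n with
  | zero =>
    refine ⟨0, congrArg init ?_⟩
    obtain ⟨q, hq⟩ := Multiset.exists_mem_of_ne_zero hI
    refine (sInf_eq_of_inter_Iic_eq (t := t) (finite_release I).bddBelow
      (finite_release J).bddBelow (fun a ha => ⟨?_, ?_⟩) ⟨_, hn, ?_⟩).symm
    · rintro ⟨q, hq, rfl⟩
      exact ⟨q, mem_of_filter_eq hIJ hq ha, rfl⟩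
    · rintro ⟨q, hq, rfl⟩
      exact ⟨q, mem_of_filter_eq hIJ.symm hq ha, rfl⟩
    · exact Set.Nonempty.csInf_mem ⟨q.release, q, hq, rfl⟩ (finite_release I)
  | succ n ih =>
    have hv := isValid_run hw hw0 I n
    rw [run_succ] at hn ⊢
    obtain ⟨m, hm⟩ := ih ((hv.clock_le_step I).trans hn)
    by_cases hdone : (run I w n).IsDone I w
    · exact ⟨m, by rw [step_of_isDone hdone, hm]⟩
    · exact ⟨m + 1, by rw [run_succ, hm, hv.step_congr hIJ hn hdone]⟩

lemma run_log_mono (I : Multiset (Request T)) (w : T → ℝ) :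
    Monotone fun n => (run I w n).log :=
  monotone_nat_of_le_succ fun n => by
    rw [run_succ]
    exact log_subset_step _ _ _

lemma run_log_subset_final (h : ∃ n, (run I w n).IsDone I w) (n : ℕ) :
    (run I w n).log ⊆ (final I w).log := by
  have hd : (run I w (sInf {n | (run I w n).IsDone I w})).IsDone I w := Nat.sInf_mem h
  set N := sInf {n | (run I w n).IsDone I w} with hN
  have hconst : ∀ k, run I w (N + k) = run I w N := by
    intro k
    induction k with
    | zero => rfl
    | succ k ih => rw [← add_assoc, run_succ, ih, step_of_isDone hd]
  have := run_log_mono I w (Nat.le_add_left n N)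
  simp only [hconst] at this
  exact this

/-- Every logged exploration takes place at the current time of some state of the run. -/
lemma exists_clock_eq {n : ℕ} {p : ℝ × T} (hp : p ∈ (run I w n).log) :
    ∃ m, (run I w m).clock = p.1 ∧ p ∈ (run I w m).log := by
  induction n with
  | zero => simp [run, init] at hp
  | succ n ih =>
    by_cases h : p ∈ (run I w n).log
    · exact ih h
    · refine ⟨n + 1, ?_, hp⟩
      rw [run_succ] at hp ⊢
      revert hp
      refine step_induction (P := fun s' => p ∈ s'.log → s'.clock = p.1) (fun e _ hp => ?_)
        (fun _ _ _ hp => absurd hp h) (fun _ _ _ hp => absurd hp h) (fun _ hp => absurd hp h)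
      rcases Finset.mem_insert.1 hp with rfl | hp
      · rfl
      · exact absurd hp h

lemma mem_final_log [Finite T] (hw : ∀ v, v ≠ ⊥ → 0 < w v) (hw0 : w ⊥ = 0)
    (hIJ : (I.filter fun q => q.release ≤ t) = J.filter fun q => q.release ≤ t)
    (hJ : ∃ n, (run J w n).IsDone J w) {p : ℝ × T} (hp : p ∈ (final I w).log) (ht : p.1 ≤ t) :
    p ∈ (final J w).log := by
  rcases eq_or_ne I 0 with rfl | hI
  · rw [final_zero hw] at hp
    exact absurd hp (Finset.notMem_empty _)
  · obtain ⟨n, hn, hp⟩ := exists_clock_eq hp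
    obtain ⟨m, hm⟩ := exists_run_eq hw hw0 hIJ hI n (hn.trans_le ht)
    exact run_log_subset_final hJ m (hm ▸ hp)

end State

variable [Fintype T]

/-! ### Competitiveness -/

omit [Fintype T] in
lemma serviceTime_mem {S : Finset (Transmission T)} {q : Request T}
    (h : (serviceTimes S q).Nonempty) : serviceTime S q ∈ serviceTimes S q := by
  refine h.csInf_mem ((S.image Transmission.time).finite_toSet.subset ?_)
  rintro t ⟨-, x, hx, rfl, -⟩
  simpa using ⟨x, hx, rfl⟩

lemma cost_eq {w : T → ℝ} (hw0 : w ⊥ = 0) {I : Multiset (Request T)}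
    {S : Finset (Transmission T)} (hS : IsFeasible I S) :
    cost w I S = total I (fun q => q.accrued (serviceTime S q)) +
      ∑ e, w e * (S.filter fun x => e ∈ x.nodes).card := by
  have h1 : (I.map fun q => q.delay (serviceTime S q)).sum =
      total I fun q => q.accrued (serviceTime S q) :=
    total_congr fun q hq => (q.accrued_of_le (serviceTime_mem (hS q hq)).1).symm
  have h2 : ∀ x : Transmission T, x.weight w = ∑ e, if e ∈ x.nodes then w e else 0 := by
    intro x
    rw [Transmission.weight, Finset.sum_filter_of_ne (p := fun v => v ≠ ⊥) fun v _ hv h => hv (h ▸ hw0),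
      Finset.sum_ite_mem, Finset.univ_inter]
  rw [cost, h1, add_comm, Finset.sum_congr rfl fun x _ => h2 x, Finset.sum_comm]
  congr 1
  refine Finset.sum_congr rfl fun e _ => ?_
  rw [← Finset.sum_filter, Finset.sum_const, nsmul_eq_mul, mul_comm]

lemma exists_isFeasible (I : Multiset (Request T)) :
    ∃ S : Finset (Transmission T), IsFeasible I S := by
  obtain ⟨t, ht⟩ := (I.toFinset.image Request.release).exists_le
  refine ⟨{⟨t, Finset.univ, Finset.mem_univ _, by simp [isLowerSet_univ]⟩}, fun q hq => ⟨t, ?_, _,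
    Finset.mem_singleton_self _, rfl, Finset.mem_univ _⟩⟩
  exact ht _ (Finset.mem_image_of_mem _ (by simpa using hq))

/-! ### Bounds along the run, and termination -/

namespace State

variable {I J : Multiset (Request T)} {w : T → ℝ} {s : State T} {t : ℝ}

omit [Fintype T] in
lemma covered_init {q : Request T} (hq : q ∈ I) :
    (init (sInf {r | ∃ q ∈ I, q.release = r}) : State T).covered q = q.delay q.release :=
  q.accrued_of_ge (sInf_release_le hq)

/-- Initially only the last summand of `idleBound` can be nonzero, so the potential starts at no
more than `l`. -/
lemma flow_run_le (hw : ∀ v, v ≠ ⊥ → 0 < w v) (hw0 : w ⊥ = 0) (I : Multiset (Request T)) {l : ℝ}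
    (hl : 0 ≤ l) (hlw : ∀ v, v ≠ ⊥ → 4 * l ≤ w v) (n : ℕ) : (run I w n).flow I w l ≤ l := by
  induction n with
  | zero =>
    change (init _).flow I w l ≤ l
    have h1 : total I (fun q => (init (sInf {r | ∃ q ∈ I, q.release = r})).covered q -
        q.delay q.release) = 0 :=
      (total_congr fun q hq => by rw [covered_init hq, sub_self]).trans (total_zero I)
    set s : State T := init (sInf {r | ∃ q ∈ I, q.release = r}) with hs
    have h2 : s.steps + s.idleBound w ≤ 1 := by
      have : (s.explored.filter fun x => x ≠ ⊥ ∧ 0 < s.budget x) = ∅ := by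
        ext x
        simp [hs, init]
      unfold idleBound
      rw [this, if_pos (by rfl), show s.steps = 0 from rfl, Finset.card_empty]
      split_ifs <;> simp
    have h3 : ((s.steps + s.idleBound w : ℕ) : ℝ) ≤ 1 := by exact_mod_cast h2
    have h4 := mul_le_mul_of_nonneg_left h3 hl
    unfold flow
    rw [h1]
    simpa [hs, init] using h4
  | succ n ih => exact run_succ I w n ▸ ((isValid_run hw hw0 I n).flow_step_le hl hlw).trans ih

lemma IsValid.le_flow (hs : s.IsValid w) (l : ℝ) :
    ∑ p ∈ s.log, w p.2 + l * ((s.steps + s.idleBound w : ℕ) : ℝ) +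
      total I (fun q => s.covered q - q.delay q.release) +
      (3 * treeDepth T + 1) * s.budget ⊥ ≤ s.flow I w l := by
  have h1 : 0 ≤ ∑ e, 3 * level e * s.counter e := Finset.sum_nonneg fun e _ =>
    mul_nonneg (by linarith [one_le_level e]) (hs.counter_nonneg e)
  have h2 : (3 * level (⊥ : T) - 2) * s.budget ⊥ ≤ ∑ e, (3 * level e - 2) * s.budget e := by
    rw [← Finset.sum_erase_add _ _ (Finset.mem_univ ⊥)]
    refine le_add_of_nonneg_left (Finset.sum_nonneg fun e he => ?_)
    exact mul_nonneg (by linarith [one_le_level e])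
      (hs.budget_nonneg e (Finset.ne_of_mem_erase he))
  rw [level_bot] at h2
  unfold flow
  linarith

omit [Fintype T] in
lemma nonneg_of_pos (hw : ∀ v, v ≠ ⊥ → 0 < w v) (hw0 : w ⊥ = 0) (v : T) : 0 ≤ w v := by
  rcases eq_or_ne v ⊥ with rfl | h
  exacts [hw0.ge, (hw v h).le]

lemma neg_budget_bot_run_le (hw : ∀ v, v ≠ ⊥ → 0 < w v) (hw0 : w ⊥ = 0)
    {S : Finset (Transmission T)} (hS : IsFeasible I S) (n : ℕ) :
    - (run I w n).budget ⊥ + total I (fun q => q.delay q.release) ≤ cost w I S := by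
  have hwn := nonneg_of_pos hw hw0
  have ho : ∀ q ∈ I, q.release ≤ serviceTime S q ∧
      ∃ y ∈ S, y.time = serviceTime S q ∧ q.leaf ∈ y.nodes := fun q hq => serviceTime_mem (hS q hq)
  have key : ∃ t τ V G, (run I w n).IsComparable I w S (serviceTime S) t τ V G := by
    induction n with
    | zero =>
      set c := sInf {r | ∃ q ∈ I, q.release = r} with hc
      -- The fictitious last explorations lie strictly before the first arrival `c`, so the third
      -- alternative of `value` holds although the initial budgets are zero.
      refine ⟨fun _ => c - 1, fun _ => c, 0, 0, fun _ => (sub_one_lt c).le, fun _ _ _ _ _ => le_rfl,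
        fun _ _ _ _ _ _ _ => rfl, fun e => .inr (.inr fun q hq => ?_), fun _ => le_rfl,
        neg_zero.symm, fun _ => le_rfl, fun _ => .inl le_rfl, ?_⟩
      · exact (sub_one_lt c).trans_le (sInf_release_le hq)
      · have h1 : total I (fun q => q.delay q.release) ≤
            total I fun q => min ((init c).covered q) (q.accrued (serviceTime S q)) :=
          total_mono fun q hq =>
            le_min (covered_init hq).ge (q.delay_release_le_accrued _)
        have h2 : 0 ≤ ∑ e, w e * (visits S e (c - 1) : ℝ) :=
          Finset.sum_nonneg fun e _ => mul_nonneg (hwn e) (Nat.cast_nonneg _)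
        simp only [Pi.zero_apply, Finset.sum_const_zero, zero_add, add_zero]
        exact h1.trans (le_add_of_nonneg_right h2)
    | succ n ih =>
      obtain ⟨t, τ, V, G, h⟩ := ih
      rw [run_succ]
      exact h.step (isValid_run hw hw0 I n) hwn ho
  obtain ⟨t, τ, V, G, h⟩ := key
  rw [cost_eq hw0 hS]
  exact h.neg_budget_bot_le (isValid_run hw hw0 I n) hwn hw0

/-- With `l > 0` the potential charges `l` for each step, while the root's investment stays bounded
by the cost of any fixed feasible schedule. An endless run would violate this. -/
lemma exists_isDone (hw : ∀ v, v ≠ ⊥ → 0 < w v) (hw0 : w ⊥ = 0) (I : Multiset (Request T)) :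
    ∃ n, (run I w n).IsDone I w := by
  by_contra! hc
  obtain ⟨l, hl, hlw⟩ : ∃ l : ℝ, 0 < l ∧ ∀ v, v ≠ ⊥ → 4 * l ≤ w v := by
    obtain ⟨m, hm⟩ := ((Finset.univ.erase (⊥ : T)).image fun v => (w v)⁻¹).exists_le
    refine ⟨(4 * max m 1)⁻¹, by positivity, fun v hv => ?_⟩
    have h1 : (w v)⁻¹ ≤ max m 1 := (hm _ (Finset.mem_image_of_mem _ (by simpa using hv))).trans
      (le_max_left _ _)
    have h2 := inv_le_of_inv_le₀ (hw v hv) h1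
    rw [mul_inv, ← mul_assoc, mul_inv_cancel₀ (by norm_num : (4 : ℝ) ≠ 0), one_mul]
    exact h2
  obtain ⟨S, hS⟩ := exists_isFeasible I
  have hsteps : ∀ n, (run I w n).steps = n := by
    intro n
    induction n with
    | zero => rfl
    | succ n ih => rw [run_succ, steps_step (hc n), ih]
  obtain ⟨n, hn⟩ := exists_nat_gt ((l + (3 * treeDepth T + 1) * cost w I S) / l)
  rw [div_lt_iff₀ hl] at hn
  have hv := isValid_run hw hw0 I n
  have h1 := (hv.le_flow (I := I) l).trans (flow_run_le hw hw0 I hl.le hlw n)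
  have h2 := neg_budget_bot_run_le hw hw0 hS n
  have h3 : 0 ≤ total I (fun q => (run I w n).covered q - q.delay q.release) :=
    total_nonneg fun q _ => sub_nonneg.2 (hv.release_le_covered q)
  have h4 : 0 ≤ ∑ p ∈ (run I w n).log, w p.2 :=
    Finset.sum_nonneg fun p _ => nonneg_of_pos hw hw0 p.2
  have h5 : 0 ≤ total I fun q => q.delay q.release := total_nonneg fun q _ => q.delay_nonneg
  have h6 : 0 ≤ l * ((run I w n).idleBound w : ℝ) := by positivity
  have h7 := mul_le_mul_of_nonneg_left (by linarith : -(run I w n).budget ⊥ ≤ cost w I S)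
    (by positivity : 0 ≤ 3 * (treeDepth T : ℝ) + 1)
  rw [hsteps, Nat.cast_add] at h1
  linarith

end State

/-! ### From the log to a schedule, and its cost -/

open State

/-- The transmission at time `t` of the nodes logged at that time. -/
def transmission (L : Finset (ℝ × T)) (t : ℝ) : Transmission T where
  time := t
  nodes := Finset.univ.filter fun v => ∀ u ≤ v, u ≠ ⊥ → (t, u) ∈ L
  root_mem := by simp +contextual
  ancestor_mem := by
    intro a b hba ha
    simp only [Finset.coe_filter, Finset.mem_univ, true_and, Set.mem_ofPred_eq] at ha ⊢
    exact fun u hu => ha u (hu.trans hba)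

/-- The schedule that transmits the logged nodes. -/
def scheduleOf (L : Finset (ℝ × T)) : Finset (Transmission T) :=
  (L.image Prod.fst).image (transmission L)

lemma mem_scheduleOf {L : Finset (ℝ × T)} {x : Transmission T} :
    x ∈ scheduleOf L ↔ ∃ p ∈ L, transmission L p.1 = x := by
  simp [scheduleOf]

/-- Distinct transmissions have distinct times, and each non-root node transmitted at time `t` has
its own log entry at `t`. -/
lemma sum_weight_scheduleOf_le {w : T → ℝ} (hw : ∀ v, 0 ≤ w v) (L : Finset (ℝ × T)) :
    ∑ x ∈ scheduleOf L, x.weight w ≤ ∑ p ∈ L, w p.2 := by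
  rw [scheduleOf, Finset.sum_image fun a _ b _ h => congrArg Transmission.time h,
    ← Finset.sum_fiberwise_of_maps_to (t := L.image Prod.fst) (g := Prod.fst)
      fun p hp => Finset.mem_image_of_mem _ hp]
  refine Finset.sum_le_sum fun a _ => ?_
  rw [Transmission.weight, ← Finset.sum_image (f := fun p : ℝ × T => w p.2) (g := fun v => (a, v))
    fun u _ v _ h => congrArg Prod.snd h]
  refine Finset.sum_le_sum_of_subset_of_nonneg (fun p hp => ?_) fun p _ _ => hw p.2
  obtain ⟨v, hv, rfl⟩ := Finset.mem_image.1 hp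
  obtain ⟨hv, hne⟩ := Finset.mem_filter.1 hv
  exact Finset.mem_filter.2 ⟨(Finset.mem_filter.1 hv).2 v le_rfl hne, rfl⟩

lemma mem_scheduleOf_of_forall_mem {L L' : Finset (ℝ × T)} {t : ℝ}
    (h : ∀ p : ℝ × T, p.1 ≤ t → (p ∈ L ↔ p ∈ L')) {x : Transmission T} (hx : x ∈ scheduleOf L)
    (hxt : x.time ≤ t) : x ∈ scheduleOf L' := by
  obtain ⟨p, hp, rfl⟩ := mem_scheduleOf.1 hx
  refine mem_scheduleOf.2 ⟨p, (h p hxt).1 hp, ?_⟩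
  refine (Transmission.mk.injEq ..).mpr ⟨rfl, Finset.filter_congr fun v _ => ?_⟩
  exact forall₃_congr fun u _ _ => (h (p.1, u) hxt).symm

/-- The online algorithm. -/
def algorithm (w : T → ℝ) (hw : ∀ v, v ≠ ⊥ → 0 < w v) (hw0 : w ⊥ = 0) : OnlineAlgorithm T where
  schedule I := scheduleOf (final I w).log
  nonanticipating I J t hIJ := by
    have h : ∀ p : ℝ × T, p.1 ≤ t → (p ∈ (final I w).log ↔ p ∈ (final J w).log) := fun p hp =>
      ⟨fun h => mem_final_log hw hw0 hIJ (exists_isDone hw hw0 J) h hp,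
        fun h => mem_final_log hw hw0 hIJ.symm (exists_isDone hw hw0 I) h hp⟩
    ext x
    simp only [Finset.mem_filter]
    exact ⟨fun hx => ⟨mem_scheduleOf_of_forall_mem h hx.1 hx.2, hx.2⟩,
      fun hx => ⟨mem_scheduleOf_of_forall_mem (fun p hp => (h p hp).symm) hx.1 hx.2, hx.2⟩⟩

lemma final_service {w : T → ℝ} (hw : ∀ v, v ≠ ⊥ → 0 < w v) (hw0 : w ⊥ = 0)
    {I : Multiset (Request T)} {q : Request T} (hq : q ∈ I) :
    ∃ t ∈ serviceTimes (scheduleOf (final I w).log) q, q.accrued t ≤ (final I w).covered q := by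
  have hv : (final I w).IsValid w := isValid_run hw hw0 I _
  have hd : (final I w).IsDone I w := Nat.sInf_mem (exists_isDone hw hw0 I)
  obtain ⟨t, ht, hr, hcov⟩ := hv.served q (hd.2.2 q hq)
  refine ⟨t, ⟨hr, _, mem_scheduleOf.2 ⟨_, ht, rfl⟩, rfl, ?_⟩, hcov⟩
  refine Finset.mem_filter.2 ⟨Finset.mem_univ _, fun u hu hne => ?_⟩
  rcases hu.eq_or_lt with rfl | hlt
  exacts [ht, hv.log_lower _ ht u hlt hne]

lemma isFeasible_algorithm {w : T → ℝ} (hw : ∀ v, v ≠ ⊥ → 0 < w v) (hw0 : w ⊥ = 0)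
    (I : Multiset (Request T)) : IsFeasible I ((algorithm w hw hw0).schedule I) := fun _ hq =>
  let ⟨t, ht, _⟩ := final_service hw hw0 hq
  ⟨t, ht⟩

theorem cost_algorithm_le {w : T → ℝ} (hw : ∀ v, v ≠ ⊥ → 0 < w v) (hw0 : w ⊥ = 0)
    {I : Multiset (Request T)} {S : Finset (Transmission T)} (hS : IsFeasible I S) :
    cost w I ((algorithm w hw hw0).schedule I) ≤ (3 * treeDepth T + 1) * cost w I S := by
  have hv : (final I w).IsValid w := isValid_run hw hw0 I _
  have hwn := nonneg_of_pos hw hw0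
  have h1 := sum_weight_scheduleOf_le hwn (final I w).log
  have h2 : (I.map fun q => q.delay (serviceTime ((algorithm w hw hw0).schedule I) q)).sum ≤
      total I (fun q => (final I w).covered q - q.delay q.release) +
        total I (fun q => q.delay q.release) := by
    rw [← total_add]
    refine total_mono fun q hq => ?_
    obtain ⟨t, ht, hcov⟩ := final_service hw hw0 hq
    have hle : serviceTime ((algorithm w hw hw0).schedule I) q ≤ t :=
      csInf_le ⟨q.release, fun _ h => h.1⟩ ht
    rw [← q.accrued_of_le (serviceTime_mem (isFeasible_algorithm hw hw0 I q hq)).1,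
      sub_add_cancel]
    exact (q.accrued_monotone hle).trans hcov
  -- Steps cost nothing here: `l = 0` removes the additive term needed for termination.
  have h3 : (final I w).flow I w 0 ≤ 0 :=
    flow_run_le hw hw0 I le_rfl (fun v hv => by simpa using (hw v hv).le) _
  have h4 := hv.le_flow (I := I) 0
  have h5 : - (final I w).budget ⊥ + total I (fun q => q.delay q.release) ≤ cost w I S :=
    neg_budget_bot_run_le hw hw0 hS _
  have h6 := mul_le_mul_of_nonneg_left h5 (by positivity : 0 ≤ 3 * (treeDepth T : ℝ) + 1)
  have h7 : 0 ≤ total I fun q => q.delay q.release := total_nonneg fun q _ => q.delay_nonneg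
  have h8 : 0 ≤ (treeDepth T : ℝ) * total I fun q => q.delay q.release :=
    mul_nonneg (Nat.cast_nonneg _) h7
  have h9 : cost w I ((algorithm w hw hw0).schedule I) =
      ∑ x ∈ scheduleOf (final I w).log, x.weight w +
        (I.map fun q => q.delay (serviceTime ((algorithm w hw hw0).schedule I) q)).sum := rfl
  rw [h9]
  linarith

lemma treeDepth_pos_of_isLeaf {v : T} (hv : IsLeaf v) : 1 ≤ treeDepth T := by
  have h1 : (Set.Iio v).ncard ≤ treeDepth T :=
    Finset.le_sup (f := fun v : T => (Set.Iio v).ncard) (Finset.mem_univ v)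
  have h2 : 0 < (Set.Iio v).ncard :=
    (Set.ncard_pos (Set.toFinite _)).2 ⟨⊥, bot_lt_iff_ne_bot.2 hv.1⟩
  omega

omit [Fintype T] in
lemma cost_nonneg {w : T → ℝ} (hw : ∀ v, 0 ≤ w v) {I : Multiset (Request T)}
    {S : Finset (Transmission T)} (hS : IsFeasible I S) : 0 ≤ cost w I S := by
  refine add_nonneg (Finset.sum_nonneg fun x _ => Finset.sum_nonneg fun v _ => hw v)
    (total_nonneg fun q hq => ?_)
  rw [← q.accrued_of_le (serviceTime_mem (hS q hq)).1]
  exact q.delay_nonneg.trans (q.delay_release_le_accrued _)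

lemma isCompetitive_algorithm {w : T → ℝ} (hw : ∀ v, v ≠ ⊥ → 0 < w v) (hw0 : w ⊥ = 0) :
    (algorithm w hw hw0).IsCompetitive w (4 * (treeDepth T : ℝ) ^ 2) := by
  refine fun I => ⟨isFeasible_algorithm hw hw0 I, fun S hS => ?_⟩
  have hc := cost_nonneg (nonneg_of_pos hw hw0) hS
  -- If the depth is zero there are no leaves, so the instance is empty and the cost must vanish; a
  -- request forces depth at least one, whence `3 * D + 1 ≤ 4 * D ^ 2`.
  rcases eq_or_ne I 0 with rfl | hI
  · have : cost w 0 ((algorithm w hw hw0).schedule 0) = 0 := by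
      simp [cost, algorithm, final_zero hw, scheduleOf]
    rw [this]
    positivity
  · obtain ⟨q, -⟩ := Multiset.exists_mem_of_ne_zero hI
    have hD : (1 : ℝ) ≤ treeDepth T := by exact_mod_cast treeDepth_pos_of_isLeaf q.isLeaf
    exact (cost_algorithm_le hw hw0 hS).trans (mul_le_mul_of_nonneg_right (by nlinarith) hc)

omit [Fintype T] in
lemma cost_update_bot (w : T → ℝ) (I : Multiset (Request T)) (S : Finset (Transmission T)) :
    cost (Function.update w ⊥ 0) I S = cost w I S := by
  have : ∀ x : Transmission T, x.weight (Function.update w ⊥ 0) = x.weight w := fun x =>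
    Finset.sum_congr rfl fun v hv => Function.update_of_ne (Finset.mem_filter.1 hv).2 _ _
  simp only [cost, this]

end

end MultilevelAggregation

theorem mainTheorem1 :
    ∃ C : ℝ, 0 < C ∧
      ∀ (T : RootedTree) [Fintype T] (w : T → ℝ), (∀ v : T, v ≠ ⊥ → 0 < w v) →
        ∃ A : MultilevelAggregation.OnlineAlgorithm T,
          A.IsCompetitive w (C * (MultilevelAggregation.treeDepth T : ℝ) ^ 2) := by
  classical
  refine ⟨4, by norm_num, fun T _ w hw => ?_⟩
  -- The value of `w` at the root is arbitrary and enters no cost, so it may be set to zero as the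
  -- analysis requires.
  have hw' : ∀ v : T, v ≠ ⊥ → 0 < Function.update w ⊥ 0 v := fun v hv => by
    rw [Function.update_of_ne hv]
    exact hw v hv
  refine ⟨MultilevelAggregation.algorithm _ hw' (Function.update_self ..), fun I => ?_⟩
  have h := MultilevelAggregation.isCompetitive_algorithm hw' (Function.update_self ..) I
  refine ⟨h.1, fun S hS => ?_⟩
  have h' := h.2 S hS
  simp only [MultilevelAggregation.cost_update_bot] at h'
  convert h' using 1
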